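/- **Setting.** Pairs $(X,A)$ consist of a compactly generated space $X$ and a closed subset $A$; products carry the compactly generated topology, and $(X,A)\times(Y,B)=(X\times Y,\,X\times B\cup A\times Y)$. For a space $X$ let $|X|$ be the realization of its singular complex, and let $L(X,A)=|X|/|A|$, a pointed space. Let $F$ be a functor from pairs to pointed spaces with a natural pairing $\omega:F(X,A)\wedge L(Y,B)\to F((X,A)\times(Y,B))$ that is unital and associative, and an augmentation $\varepsilon:L\to F$ compatible with the pairings. (Every homology theory with pairing and augmentation is an example.) For a map of pairs $h:(X,A)\times I\to (Y,B)$ let $\widehat F(h):F(X,A)\wedge I^+\to F(Y,B)$ be the composite $F(X,A)\wedge I^+\to F(X,A)\wedge L(I)\to F((X,A)\times I)\to F(Y,B)$ of the canonical map $I\to |I|$, $\omega$ and $F(h)$. A fiberwise smooth bundle over $B$ is a locally trivial bundle of compact smooth manifolds with boundary. For such bundles $E_0<E_1$ means that $E_0$ is a subbundle of $E_1$ such that, in each fiber, $M_0=(E_0)_b$ is a compact codimension zero submanifold of $M=(E_1)_b$ given near its frontier points by $x_2\le 0$ in smooth charts of $M$ in $\{x_1\ge 0\}\subset\mathbb R^n$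 in which $\overline{M-M_0}$ is given by $x_2\ge0$, with its smooth structure obtained by straightening the angle. A fiberwise smooth map $(E_0<E_1)\downarrow(B,A)\to(\overline E_0<\overline E_1)\downarrow(\overline B,\overline A)$ that is an embedding on each fiber is an excision if on each fiber it takes $E_0$ onto the intersection of the image of $E_1$ with $\overline E_0$, the union of the image of $E_1$ and $\overline E_0$ is $\overline E_1$, and each of the two submanifolds occurring is related to the larger ones by $<$. For functors $G,G'$ from a category to pointed spaces and a space $K$, a simplicial transformation $G\wedge K^+\to G'$ on a simplicial subset of the nerve consists of pointed maps $G(C_0)\wedge K^+\wedge\Delta_q^+\to G'(C_q)$, one for each simplex $C_0\to\dots\to C_q$ in the subset, compatible with the simplicial operators. Let $T$ be a transfer for $F$. It contains a simplicial transformation that assigns to each simplex $E_0\to\dots\to E_q$, $E_j=(E_{0j}<E_{1j})\downarrow(B_j,A_j)$, whose maps are excisions, a pointed map $L(B_0,A_0)\wedge\Delta_q^+\to F(E_{1q},E_{1q}\downarrow A_q)$; in particular, with $\Phi$ the empty bundle, it gives maps $T(E)=T(\Phi<E):L(B,A)\to F(E,E\downarrow A)$, and for a fiberwise diffeomorphism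 $\phi:E_0\to E_1$ over $B$ a homotopy $T(\phi):F(\phi)T(E_0)\sim T(E_1)$. On the category of pairs $(E\downarrow(B,A),\Delta)$, where $E$ is fiberwise diffeomorphic to an orthogonal disk bundle and $\Delta:B\to E-\dot E$ is a section ($\dot E$ the fiberwise boundary), with section-preserving fiberwise diffeomorphisms as maps, it also contains a simplicial homotopy, $L\wedge I^+\to F$, between $T$ and $F(\Delta)\varepsilon(B,A)$. On the object $(E,\Delta)$ the latter is a path $$\mathbf d(E,\Delta):F(\Delta)\varepsilon(B,A)\ \sim\ T(E).$$ No other property of the transfer is assumed. An expansion $(\phi,\lambda):E_0\to E_1$ for $E_0<E_1$ over $(B,A)$, with inclusion $i_{01}$, consists of a fiberwise diffeomorphism $\phi:E_0\to E_1$ over $B$ and a map $\lambda:E_0\times I\to E_1$ over $B$ with $\lambda_0=i_{01}$ and $\lambda_1=\phi$. Let $$\mathbf c(\phi,\lambda):F(i_{01})T(E_0)\ \sim\ T(E_1)$$ be the path $\widehat F(\lambda)(T(E_0)\wedge 1):F(i_{01})T(E_0)\sim F(\phi)T(E_0)$ followed by $T(\phi):F(\phi)T(E_0)\sim T(E_1)$.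 In a composite $\beta\cdot\alpha$ of paths of pointed maps, $\alpha$ is traversed first. **Theorem.** (1) Let $E_0<E_1<E_2$ over $(B,A)$ with $E_0<E_2$, let $(\phi_{01},\lambda_{01}):E_0\to E_1$ and $(\phi_{12},\lambda_{12}):E_1\to E_2$ be expansions, and let $(\phi_{02},\lambda_{02}):E_0\to E_2$ be the expansion $\phi_{02}=\phi_{12}\phi_{01}$, $(\lambda_{02})_t=(\lambda_{12})_t(\lambda_{01})_t$. Then $$\mathbf c(\phi_{02},\lambda_{02})\ \sim\ \mathbf c(\phi_{12},\lambda_{12})\cdot F(i_{12})\mathbf c(\phi_{01},\lambda_{01})$$ as paths from $F(i_{02})T(E_0)$ to $T(E_2)$, by a homotopy rel endpoints through paths of pointed maps. (2) Let $E_0<E_1$ over $(B,A)$, where $E_0$ and $E_1$ are fiberwise diffeomorphic to orthogonal disk bundles, let $\Delta_j:B\to E_j-\dot E_j$ be sections with $i_{01}\Delta_0=\Delta_1$, and let $(\phi,\lambda):E_0\to E_1$ be an expansion such that $\phi\Delta_0=\Delta_1$ and $\lambda_t\Delta_0=\Delta_1$ for $0\le t\le 1$. Then $$\mathbf c(\phi,\lambda)\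 \sim\ \mathbf d(E_1,\Delta_1)\cdot F(i_{01})\mathbf d(E_0,\Delta_0)^{-1}$$ as paths from $F(i_{01})T(E_0)$ to $T(E_1)$, by a homotopy rel endpoints through paths of pointed maps. -/

import Mathlib

open CategoryTheory Topology Opposite
open scoped ContDiff unitInterval

namespace RefinedTransfer

noncomputable section

/-! ### Pointed spaces and pairs of compactly generated spaces -/

/-- A pointed topological space. -/
structure PtdTop where
  carrier : Type
  [top : TopologicalSpace carrier]
  pt : carrier

attribute [instance] PtdTop.top

/-- A pointed map. -/
@[ext]
structure PtdTop.Hom (X Y : PtdTop) where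
  toMap : C(X.carrier, Y.carrier)
  map_pt : toMap X.pt = Y.pt

instance : Category PtdTop where
  Hom := PtdTop.Hom
  id X := ⟨ContinuousMap.id _, rfl⟩
  comp f g := ⟨g.toMap.comp f.toMap, by simp [f.map_pt, g.map_pt]⟩

/-- A pair `(X, A)` where `X` is compactly generated and `A` is a closed subspace. -/
structure CGPair where
  carrier : Type
  [top : TopologicalSpace carrier]
  [cg : CompactlyGeneratedSpace carrier]
  sub : Set carrier
  isClosed_sub : IsClosed sub

attribute [instance] CGPair.top CGPair.cg

/-- A map of pairs. -/
@[ext]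
structure CGPair.Hom (X Y : CGPair) where
  toMap : C(X.carrier, Y.carrier)
  mapsTo : ∀ x ∈ X.sub, toMap x ∈ Y.sub

instance : Category CGPair where
  Hom := CGPair.Hom
  id X := ⟨ContinuousMap.id _, fun _ h => h⟩
  comp f g := ⟨g.toMap.comp f.toMap, fun x h => g.mapsTo _ (f.mapsTo x h)⟩

/-- The product of two spaces with the compactly generated topology. -/
def KProd (X Y : Type) : Type := X × Y

instance (X Y : Type) [TopologicalSpace X] [TopologicalSpace Y] :
    TopologicalSpace (KProd X Y) :=
  TopologicalSpace.compactlyGenerated.{0} (X × Y)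

/-- The point `(x, y)` of `KProd X Y`. -/
def KProd.mk {X Y : Type} (x : X) (y : Y) : KProd X Y := (x, y)

section KProd

variable {X Y Z : Type} [TopologicalSpace X] [TopologicalSpace Y] [TopologicalSpace Z]

theorem KProd.continuous_of (f : KProd X Y → Z)
    (h : ∀ (S : CompHaus.{0}) (u : C(S, X)) (v : C(S, Y)),
      Continuous fun s => f (u s, v s)) : Continuous f := by
  refine continuous_from_compactlyGenerated (X := X × Y) f fun S g => ?_
  exact h S ⟨fun s => (g s).1, by fun_prop⟩ ⟨fun s => (g s).2, by fun_prop⟩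

theorem KProd.continuous_of_prod (f : X × Y → Z) (h : Continuous f) :
    Continuous (fun q : KProd X Y => f q) :=
  KProd.continuous_of _ fun _ u v => h.comp (u.continuous.prodMk v.continuous)

theorem KProd.continuous_fst : Continuous (fun q : KProd X Y => q.1) :=
  KProd.continuous_of_prod Prod.fst _root_.continuous_fst

theorem KProd.continuous_snd : Continuous (fun q : KProd X Y => q.2) :=
  KProd.continuous_of_prod Prod.snd _root_.continuous_snd

theorem KProd.continuous_mk (S : CompHaus.{0}) (u : C(S, X)) (v : C(S, Y)) :
    Continuous (fun s => KProd.mk (u s) (v s)) := by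
  have h : Continuous[inferInstance, TopologicalSpace.compactlyGenerated.{0} (X × Y)]
      (fun q : ((i : (S : CompHaus.{0}) × C(S, X × Y)) × i.fst) => q.1.2 q.2) :=
    continuous_coinduced_rng
  exact @Continuous.comp _ _ (KProd X Y) _ _ _ _ _ h
    (continuous_sigmaMk (i := (⟨S, u.prodMk v⟩ : (S : CompHaus.{0}) × C(S, X × Y))))

instance : CompactlyGeneratedSpace (KProd X Y) :=
  compactlyGeneratedSpace_of_continuous_maps fun f hf =>
    KProd.continuous_of f fun S u v => hf S _ (KProd.continuous_mk S u v)

theorem KProd.continuous_mk_of_cg {W : Type} [TopologicalSpace W] [CompactlyGeneratedSpace W]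
    (u : W → X) (v : W → Y) (hu : Continuous u) (hv : Continuous v) :
    Continuous (fun w => KProd.mk (u w) (v w)) :=
  continuous_from_compactlyGeneratedSpace _ fun S _ _ _ g hg =>
    KProd.continuous_mk (CompHaus.of S) ⟨u ∘ g, hu.comp hg⟩ ⟨v ∘ g, hv.comp hg⟩

end KProd

namespace CGPair

/-- `(X, A) × (Y, B) = (X × Y, X × B ∪ A × Y)`. -/
def prod (P Q : CGPair) : CGPair where
  carrier := KProd P.carrier Q.carrier
  sub := {q | q.2 ∈ Q.sub ∨ q.1 ∈ P.sub}
  isClosed_sub := (Q.isClosed_sub.preimage KProd.continuous_snd).union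
    (P.isClosed_sub.preimage KProd.continuous_fst)

/-- The product of two maps of pairs. -/
def prodMap {P P' Q Q' : CGPair} (f : P ⟶ P') (g : Q ⟶ Q') : P.prod Q ⟶ P'.prod Q' where
  toMap := ⟨fun q => KProd.mk (f.toMap q.1) (g.toMap q.2),
    KProd.continuous_mk_of_cg _ _ (f.toMap.continuous.comp KProd.continuous_fst)
      (g.toMap.continuous.comp KProd.continuous_snd)⟩
  mapsTo q hq := hq.imp (g.mapsTo q.2) (f.mapsTo q.1)

/-- The associativity identification `((X × Y) × Z) = (X × (Y × Z))`. -/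
def assoc (P Q R : CGPair) : (P.prod Q).prod R ⟶ P.prod (Q.prod R) where
  toMap := ⟨fun q => KProd.mk q.1.1 (KProd.mk q.1.2 q.2),
    KProd.continuous_mk_of_cg _ _ (KProd.continuous_fst.comp KProd.continuous_fst)
      (KProd.continuous_mk_of_cg _ _ (KProd.continuous_snd.comp KProd.continuous_fst)
        KProd.continuous_snd)⟩
  mapsTo := by
    rintro q (h | h | h)
    · exact Or.inl (Or.inl h)
    · exact Or.inl (Or.inr h)
    · exact Or.inr h

/-- The pair `(X, ∅)`. -/
def ofSpace (X : Type) [TopologicalSpace X] [CompactlyGeneratedSpace X] : CGPair where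
  carrier := X
  sub := ∅
  isClosed_sub := isClosed_empty

/-- The identification `(X, A) × * = (X, A)`. -/
def prodPoint (P : CGPair) : P.prod (ofSpace PUnit) ⟶ P where
  toMap := ⟨fun q => q.1, KProd.continuous_fst⟩
  mapsTo := by
    rintro q (h | h)
    · exact h.elim
    · exact h

end CGPair

/-! ### The functor `L(X, A) = |X| / |A|` -/

/-- The realization of the singular complex of `X`. -/
abbrev SingReal (X : Type) [TopologicalSpace X] : TopCat.{0} :=
  SSet.toTop.obj (TopCat.toSSet.obj (TopCat.of X))

/-- The map induced on realizations of singular complexes. -/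
abbrev singRealMap {X Y : Type} [TopologicalSpace X] [TopologicalSpace Y] (f : C(X, Y)) :
    SingReal X ⟶ SingReal Y :=
  SSet.toTop.map (TopCat.toSSet.map (TopCat.ofHom f))

/-- The relation collapsing `|A|` to the base point. For `A = ∅` this adds a disjoint base
point. -/
inductive LRel (P : CGPair) : SingReal P.carrier ⊕ PUnit → SingReal P.carrier ⊕ PUnit → Prop
  | collapse (a : SingReal P.sub) :
      LRel P (Sum.inl (singRealMap ⟨Subtype.val, continuous_subtype_val⟩ a)) (Sum.inr ⟨⟩)

/-- The pointed space `|X| / |A|`. -/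
def LObj (P : CGPair) : PtdTop where
  carrier := Quot (LRel P)
  pt := Quot.mk _ (Sum.inr ⟨⟩)

/-- The class in `|X| / |A|` of a point of `|X|`. -/
def LMk (P : CGPair) (z : SingReal P.carrier) : (LObj P).carrier := Quot.mk _ (Sum.inl z)

theorem singRealMap_comp {X Y Z : Type} [TopologicalSpace X] [TopologicalSpace Y]
    [TopologicalSpace Z] (f : C(X, Y)) (g : C(Y, Z)) (z : SingReal X) :
    singRealMap (g.comp f) z = singRealMap g (singRealMap f z) := by
  have : singRealMap (g.comp f) = singRealMap f ≫ singRealMap g := by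
    simp only [singRealMap, ← Functor.map_comp]; rfl
  rw [this]; rfl

theorem singRealMap_id {X : Type} [TopologicalSpace X] (z : SingReal X) :
    singRealMap (ContinuousMap.id X) z = z := by
  have : singRealMap (ContinuousMap.id X) = 𝟙 _ := by
    simp only [singRealMap]
    exact (SSet.toTop.congr_map (TopCat.toSSet.map_id _)).trans (SSet.toTop.map_id _)
  rw [this]; rfl

/-- The map `|X| / |A| → |Y| / |B|` induced by a map of pairs. -/
def LMap {P Q : CGPair} (f : P ⟶ Q) : LObj P ⟶ LObj Q where
  toMap := ⟨Quot.map (Sum.map (singRealMap f.toMap) id) (by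
      rintro _ _ ⟨a⟩
      have key := singRealMap_comp ⟨Subtype.val, continuous_subtype_val⟩ f.toMap a
      have key' := singRealMap_comp
        (⟨fun x => ⟨f.toMap x.1, f.mapsTo x.1 x.2⟩, by fun_prop⟩ : C(P.sub, Q.sub))
        ⟨Subtype.val, continuous_subtype_val⟩ a
      have := LRel.collapse (P := Q) (singRealMap
        (⟨fun x => ⟨f.toMap x.1, f.mapsTo x.1 x.2⟩, by fun_prop⟩ : C(P.sub, Q.sub)) a)
      rw [← key'] at this
      simp only [Sum.map_inl, Sum.map_inr, id]
      rw [← key]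
      exact this),
    continuous_quot_lift _ (continuous_quot_mk.comp
      ((singRealMap f.toMap).hom.continuous.sumMap continuous_id))⟩
  map_pt := rfl

/-- The functor `L(X, A) = |X| / |A|`. -/
def L : CGPair ⥤ PtdTop where
  obj := LObj
  map := LMap
  map_id P := by
    refine PtdTop.Hom.ext (ContinuousMap.ext fun z => ?_)
    rcases z with ⟨z | z⟩
    · exact congrArg (LMk P) (singRealMap_id z)
    · rfl
  map_comp {P Q R} f g := by
    refine PtdTop.Hom.ext (ContinuousMap.ext fun z => ?_)
    rcases z with ⟨z | z⟩
    · exact congrArg (LMk R) (singRealMap_comp f.toMap g.toMap z)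
    · rfl

/-- The characteristic map `Δ^n → |X|` of a singular simplex of `X`. -/
def charMap {X : Type} [TopologicalSpace X] {n : ℕ} (s : C(stdSimplex ℝ (Fin (n + 1)), X)) :
    C(stdSimplex ℝ (Fin (n + 1)), SingReal X) :=
  (SSet.toTop.map (SSet.yonedaEquiv.symm
    ((TopCat.toSSetObjEquiv (TopCat.of X) (op (SimplexCategory.mk n))).symm s))).hom.comp
    ⟨(SimplexCategory.toTopHomeo.{0} (SimplexCategory.mk n)).symm, (SimplexCategory.toTopHomeo.{0} (SimplexCategory.mk n)).symm.continuous⟩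

theorem charMap_map {X Y : Type} [TopologicalSpace X] [TopologicalSpace Y] {n : ℕ}
    (s : C(stdSimplex ℝ (Fin (n + 1)), X)) (f : C(X, Y)) (t : stdSimplex ℝ (Fin (n + 1))) :
    singRealMap f (charMap s t) = charMap (f.comp s) t := by
  have h : SSet.yonedaEquiv.symm
      ((TopCat.toSSetObjEquiv (TopCat.of X) (op (SimplexCategory.mk n))).symm s) ≫ TopCat.toSSet.map (TopCat.ofHom f) =
      SSet.yonedaEquiv.symm ((TopCat.toSSetObjEquiv (TopCat.of Y) (op (SimplexCategory.mk n))).symm (f.comp s)) := by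
    apply SSet.yonedaEquiv.injective
    rw [Equiv.apply_symm_apply, SSet.yonedaEquiv_comp]
    erw [Equiv.apply_symm_apply]
    rfl
  simp only [charMap, ← h, Functor.map_comp]
  rfl

theorem charMap_comp {X : Type} [TopologicalSpace X] {m n : ℕ}
    (s : C(stdSimplex ℝ (Fin (n + 1)), X)) (α : Fin (m + 1) →o Fin (n + 1))
    (t : stdSimplex ℝ (Fin (m + 1))) :
    charMap s (stdSimplex.map α t) =
      charMap (s.comp ⟨stdSimplex.map α, stdSimplex.continuous_map α⟩) t := by
  have h : SSet.stdSimplex.map (SimplexCategory.mkHom α) ≫ SSet.yonedaEquiv.symm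
      ((TopCat.toSSetObjEquiv (TopCat.of X) (op (SimplexCategory.mk n))).symm s) =
      SSet.yonedaEquiv.symm ((TopCat.toSSetObjEquiv (TopCat.of X) (op (SimplexCategory.mk m))).symm
        (s.comp ⟨stdSimplex.map α, stdSimplex.continuous_map α⟩)) := by
    apply SSet.yonedaEquiv.injective
    rw [Equiv.apply_symm_apply, SSet.yonedaEquiv_comp]
    rfl
  have h2 := SimplexCategory.toTopHomeo_symm_naturality_apply.{0} (SimplexCategory.mkHom α) t
  simp only [charMap, ← h, Functor.map_comp]
  exact congrArg (SSet.toTop.map (SSet.yonedaEquiv.symm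
      ((TopCat.toSSetObjEquiv (TopCat.of X) (op (SimplexCategory.mk n))).symm s))) h2

/-- The pair `(I, ∅)`. -/
abbrev Ipair : CGPair := CGPair.ofSpace I

/-- The canonical map `I → |I|`, the characteristic map of the singular simplex
`Δ^1 ≅ I`, followed by `|I| → L(I)`. -/
def iota : C(I, (L.obj Ipair).carrier) :=
  ⟨fun t => LMk Ipair (charMap
      ⟨stdSimplexHomeomorphUnitInterval, stdSimplexHomeomorphUnitInterval.continuous⟩
      (stdSimplexHomeomorphUnitInterval.symm t)),
    continuous_quot_mk.comp (continuous_inl.comp ((charMap _).continuous.comp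
      stdSimplexHomeomorphUnitInterval.symm.continuous))⟩


/-! ### Augmented multiplicative functors -/

/-- An augmented multiplicative functor `(F, ω, ε)` on pairs of compactly generated spaces.
The pairing `ω : F(X) ∧ L(Y) → F(X × Y)` is written as a function of two variables;
`omega_continuous` is continuity for the compactly generated topology on the smash product.
In `omega_omega` and `omega_eps` the identification `|Y| × |Z| = |Y × Z|` underlying
`ω_L : L(Y) ∧ L(Z) → L(Y × Z)` is expressed through the two projections of a point of
`|Y × Z|`. -/
structure MultFunctor where
  F : CGPair ⥤ PtdTop
  omega : ∀ X Y : CGPair, (F.obj X).carrier → (L.obj Y).carrier → (F.obj (X.prod Y)).carrier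
  omega_pt_left : ∀ X Y l, omega X Y (F.obj X).pt l = (F.obj (X.prod Y)).pt
  omega_pt_right : ∀ X Y x, omega X Y x (L.obj Y).pt = (F.obj (X.prod Y)).pt
  omega_continuous : ∀ (X Y : CGPair) (K : CompHaus.{0}) (v : C(K, (L.obj Y).carrier)),
    Continuous fun q : (F.obj X).carrier × K => omega X Y q.1 (v q.2)
  omega_natural : ∀ {X X' Y Y' : CGPair} (f : X ⟶ X') (g : Y ⟶ Y') x l,
    omega X' Y' ((F.map f).toMap x) ((L.map g).toMap l) =
      (F.map (CGPair.prodMap f g)).toMap (omega X Y x l)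
  omega_point : ∀ (X : CGPair) x (z : SingReal PUnit),
    (F.map X.prodPoint).toMap (omega X (CGPair.ofSpace PUnit) x (LMk _ z)) = x
  omega_omega : ∀ (X Y Z : CGPair) x (z : SingReal (KProd Y.carrier Z.carrier)),
    (F.map (CGPair.assoc X Y Z)).toMap (omega (X.prod Y) Z
      (omega X Y x (LMk Y (singRealMap ⟨_, KProd.continuous_fst⟩ z)))
      (LMk Z (singRealMap ⟨_, KProd.continuous_snd⟩ z))) =
    omega X (Y.prod Z) x (LMk (Y.prod Z) z)
  eps : L ⟶ F
  omega_eps : ∀ (X Y : CGPair) (z : SingReal (KProd X.carrier Y.carrier)),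
    omega X Y ((eps.app X).toMap (LMk X (singRealMap ⟨_, KProd.continuous_fst⟩ z)))
      (LMk Y (singRealMap ⟨_, KProd.continuous_snd⟩ z)) =
    (eps.app (X.prod Y)).toMap (LMk (X.prod Y) z)

/-- For `h : X × I → Y`, the homotopy `F(X) ∧ I⁺ → F(X) ∧ L(I) → F(X × I) → F(Y)`. -/
def MultFunctor.hat (M : MultFunctor) {X Y : CGPair} (h : X.prod Ipair ⟶ Y) :
    C((M.F.obj X).carrier × I, (M.F.obj Y).carrier) :=
  ⟨fun q => (M.F.map h).toMap (M.omega X Ipair q.1 (iota q.2)),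
    (M.F.map h).toMap.continuous.comp (M.omega_continuous X Ipair (CompHaus.of I) iota)⟩

/-! ### Simplicial transformations -/

/-- A simplicial transformation `T : F ∧ K⁺ → G` on the simplices of the nerve of `𝒞` that
satisfy `S`: to each such simplex `C = (C₀ → ⋯ → C_p)` a pointed map
`F(C₀) ∧ K⁺ ∧ Δ_p⁺ → G(C_p)`, compatible with all the simplicial operators. -/
structure SimplicialTransformation {𝒞 : Type 1} [Category.{0} 𝒞]
    (S : ∀ {p : ℕ}, ComposableArrows 𝒞 p → Prop) (F G : 𝒞 ⥤ PtdTop)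
    (K : Type) [TopologicalSpace K] where
  app : ∀ {p : ℕ} (C : ComposableArrows 𝒞 p), S C →
    C((F.obj (C.obj 0)).carrier × K × stdSimplex ℝ (Fin (p + 1)),
      (G.obj (C.obj (Fin.last p))).carrier)
  app_pt : ∀ {p : ℕ} (C : ComposableArrows 𝒞 p) (hC : S C) (k : K)
    (t : stdSimplex ℝ (Fin (p + 1))),
    app C hC ((F.obj (C.obj 0)).pt, k, t) = (G.obj (C.obj (Fin.last p))).pt
  app_map : ∀ {p q : ℕ} (α : Fin (q + 1) →o Fin (p + 1)) (C : ComposableArrows 𝒞 p)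
    (hC : S C) (hD : S (C.whiskerLeft α.monotone.functor))
    (x : (F.obj (C.obj 0)).carrier) (k : K) (t : stdSimplex ℝ (Fin (q + 1))),
    app C hC (x, k, stdSimplex.map α t) =
      (G.map (C.map (homOfLE (Fin.le_last (α (Fin.last q)))))).toMap
        (app (C.whiskerLeft α.monotone.functor) hD
          ((F.map (C.map (homOfLE (Fin.zero_le (α 0))))).toMap x, k, t))

namespace SimplicialTransformation

variable {𝒞 : Type 1} [Category.{0} 𝒞] {S : ∀ {p : ℕ}, ComposableArrows 𝒞 p → Prop}
  {F G : 𝒞 ⥤ PtdTop} {K : Type} [TopologicalSpace K]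

theorem app_zero_simplex (T : SimplicialTransformation S F G K) (D : ComposableArrows 𝒞 0)
    (hD : S D) (hX : S (ComposableArrows.mk₀ (D.obj 0)))
    (x : (F.obj (D.obj 0)).carrier) (k : K) (t : stdSimplex ℝ (Fin 1)) :
    T.app D hD (x, k, t) = T.app (ComposableArrows.mk₀ (D.obj 0)) hX (x, k, t) := by
  obtain ⟨X, rfl⟩ := ComposableArrows.mk₀_surjective D
  rfl

theorem map_const_zero (t : stdSimplex ℝ (Fin 1)) :
    stdSimplex.map (OrderHom.const (Fin 1) (0 : Fin 2)) t =
      stdSimplexHomeomorphUnitInterval.symm 0 := by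
  rw [Homeomorph.eq_symm_apply, Subsingleton.elim t (stdSimplex.vertex 0), stdSimplex.map_vertex]
  exact stdSimplexHomeomorphUnitInterval_zero

theorem map_const_one (t : stdSimplex ℝ (Fin 1)) :
    stdSimplex.map (OrderHom.const (Fin 1) (1 : Fin 2)) t =
      stdSimplexHomeomorphUnitInterval.symm 1 := by
  rw [Homeomorph.eq_symm_apply, Subsingleton.elim t (stdSimplex.vertex 0), stdSimplex.map_vertex]
  exact stdSimplexHomeomorphUnitInterval_one

/-- The value at the initial vertex of a `1`-simplex. -/
theorem app_mk₁_zero (T : SimplicialTransformation S F G K) {X Y : 𝒞} (f : X ⟶ Y)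
    (hf : S (ComposableArrows.mk₁ f)) (hX : S (ComposableArrows.mk₀ X))
    (x : (F.obj X).carrier) (k : K) :
    T.app (ComposableArrows.mk₁ f) hf (x, k, stdSimplexHomeomorphUnitInterval.symm 0) =
      (G.map f).toMap (T.app (ComposableArrows.mk₀ X) hX (x, k, default)) := by
  have e : (ComposableArrows.mk₁ f).whiskerLeft
      (OrderHom.const (Fin 1) (0 : Fin 2)).monotone.functor = ComposableArrows.mk₀ X :=
    ComposableArrows.ext₀ rfl
  have hD : S ((ComposableArrows.mk₁ f).whiskerLeft
      (OrderHom.const (Fin 1) (0 : Fin 2)).monotone.functor) := e ▸ hX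
  have h := T.app_map (OrderHom.const (Fin 1) (0 : Fin 2)) (ComposableArrows.mk₁ f) hf hD x k
    default
  rw [map_const_zero] at h
  refine h.trans ((congrArg (G.map f).toMap (T.app_zero_simplex _ hD hX _ k default)).trans ?_)
  have hid : (F.map (𝟙 X)).toMap x = x := by rw [F.map_id X]; rfl
  exact congrArg (fun y => (G.map f).toMap (T.app (ComposableArrows.mk₀ X) hX (y, k, default))) hid

/-- The value at the terminal vertex of a `1`-simplex. -/
theorem app_mk₁_one (T : SimplicialTransformation S F G K) {X Y : 𝒞} (f : X ⟶ Y)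
    (hf : S (ComposableArrows.mk₁ f)) (hY : S (ComposableArrows.mk₀ Y))
    (x : (F.obj X).carrier) (k : K) :
    T.app (ComposableArrows.mk₁ f) hf (x, k, stdSimplexHomeomorphUnitInterval.symm 1) =
      T.app (ComposableArrows.mk₀ Y) hY ((F.map f).toMap x, k, default) := by
  have e : (ComposableArrows.mk₁ f).whiskerLeft
      (OrderHom.const (Fin 1) (1 : Fin 2)).monotone.functor = ComposableArrows.mk₀ Y :=
    ComposableArrows.ext₀ rfl
  have hD : S ((ComposableArrows.mk₁ f).whiskerLeft
      (OrderHom.const (Fin 1) (1 : Fin 2)).monotone.functor) := e ▸ hY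
  have h := T.app_map (OrderHom.const (Fin 1) (1 : Fin 2)) (ComposableArrows.mk₁ f) hf hD x k
    default
  rw [map_const_one] at h
  refine h.trans ((congrArg (G.map (𝟙 Y)).toMap
    (T.app_zero_simplex _ hD hY _ k default)).trans ?_)
  have hid : ∀ y, (G.map (𝟙 Y)).toMap y = y := fun y => by rw [G.map_id Y]; rfl
  exact hid _

end SimplicialTransformation

/-! ### Fiberwise smooth bundles -/

/-- Euclidean space `ℝⁿ`. -/
abbrev Eucl (n : ℕ) : Type := EuclideanSpace ℝ (Fin n)

/-- The half space `{x | 0 ≤ x₁}` in `ℝⁿ` (a point if `n = 0`). -/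
def halfSpace (n : ℕ) : Set (Eucl n) := {x | ∀ h : 0 < n, 0 ≤ x ⟨0, h⟩}

/-- A family `h(b, ·)` of `C^∞` maps, defined on `D ⊆ B × V`, all of whose derivatives in the
second variable are continuous on `D`. -/
def SmoothFamily {B V W : Type} [TopologicalSpace B] [NormedAddCommGroup V] [NormedSpace ℝ V]
    [NormedAddCommGroup W] [NormedSpace ℝ W] (D : Set (B × V)) (h : B × V → W) : Prop :=
  ∃ P : B × V → FormalMultilinearSeries ℝ V W,
    (∀ b, HasFTaylorSeriesUpToOn ∞ (fun y => h (b, y)) (fun y => P (b, y)) {y | (b, y) ∈ D}) ∧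
    ∀ k, ContinuousOn (fun q => P q k) D

section SmoothFamily

variable {B B' V W Z : Type} [TopologicalSpace B] [TopologicalSpace B']
  [NormedAddCommGroup V] [NormedSpace ℝ V] [NormedAddCommGroup W] [NormedSpace ℝ W]
  [NormedAddCommGroup Z] [NormedSpace ℝ Z]

theorem SmoothFamily.continuousOn {D : Set (B × V)} {h : B × V → W} (H : SmoothFamily D h) :
    ContinuousOn h D := by
  obtain ⟨P, hP, hc⟩ := H
  have h0 : ContinuousOn (fun q => (P q 0).curry0) D :=
    (continuousMultilinearCurryFin0 ℝ V W).continuous.comp_continuousOn (hc 0)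
  exact h0.congr fun q hq => ((hP q.1).zero_eq q.2 hq).symm

theorem SmoothFamily.mono {D D' : Set (B × V)} {h : B × V → W} (H : SmoothFamily D h)
    (hD : D' ⊆ D) : SmoothFamily D' h := by
  obtain ⟨P, hP, hc⟩ := H
  exact ⟨P, fun b => (hP b).mono fun y hy => hD hy, fun k => (hc k).mono hD⟩

theorem SmoothFamily.congr {D : Set (B × V)} {h h' : B × V → W} (H : SmoothFamily D h)
    (hh : ∀ q ∈ D, h' q = h q) : SmoothFamily D h' := by
  obtain ⟨P, hP, hc⟩ := H
  exact ⟨P, fun b => (hP b).congr fun y hy => hh _ hy, hc⟩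

theorem SmoothFamily.contDiffOn {D : Set (B × V)} {h : B × V → W} (H : SmoothFamily D h) (b : B) :
    ContDiffOn ℝ ∞ (fun y => h (b, y)) {y | (b, y) ∈ D} := by
  obtain ⟨P, hP, -⟩ := H
  exact (hP b).contDiffOn

theorem SmoothFamily.comp {D : Set (B × V)} {D' : Set (B' × W)} {h : B × V → W} {g : B' × W → Z}
    {f : B → B'} (Hg : SmoothFamily D' g) (Hh : SmoothFamily D h) (hf : Continuous f)
    (hm : ∀ q ∈ D, (f q.1, h q) ∈ D') : SmoothFamily D (fun q => g (f q.1, h q)) := by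
  have hcont := Hh.continuousOn
  obtain ⟨P, hP, hc⟩ := Hh
  obtain ⟨Q, hQ, hd⟩ := Hg
  refine ⟨fun q => (Q (f q.1, h q)).taylorComp (P q), fun b => ?_, fun k => ?_⟩
  · exact (hQ (f b)).comp (hP b) fun y hy => hm _ hy
  · have hF : ContinuousOn (fun q : B × V => (f q.1, h q)) D :=
      (hf.comp continuous_fst).continuousOn.prodMk hcont
    refine continuousOn_finsetSum _ fun c _ => ?_
    have h1 : ContinuousOn (fun q : B × V => Q (f q.1, h q) c.length) D := (hd _).comp hF hm
    have h2 : ContinuousOn (fun q : B × V => fun m => P q (c.partSize m)) D :=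
      continuousOn_pi.2 fun m => hc _
    have h3 := (c.compAlongOrderedFinpartitionL ℝ V W Z).continuous.comp_continuousOn h1
    exact h3.eval h2

end SmoothFamily

/-- A fiberwise chart of `p : E → B`: a homeomorphism over `B` of an open subset of `E` onto an
open subset of `B × {x ∈ ℝⁿ | 0 ≤ x₁}`. -/
structure FiberChart {E B : Type} [TopologicalSpace E] [TopologicalSpace B] (p : E → B) where
  dim : ℕ
  e : PartialEquiv E (B × Eucl dim)
  open_source : IsOpen e.source
  open_target : ∃ W : Set (B × Eucl dim), IsOpen W ∧ e.target = W ∩ {q | q.2 ∈ halfSpace dim}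
  continuousOn_toFun : ContinuousOn e e.source
  continuousOn_invFun : ContinuousOn e.symm e.target
  fst_eq : ∀ x ∈ e.source, (e x).1 = p x

/-- In the charts `c` near `x` and `c'` near `g x`, the map `g` is a `C^∞` map in the fiber
direction whose fiberwise derivatives vary continuously. -/
def SmoothAt {E B E' B' : Type} [TopologicalSpace E] [TopologicalSpace B] [TopologicalSpace E']
    [TopologicalSpace B'] {p : E → B} {p' : E' → B'} (c : FiberChart p) (c' : FiberChart p')
    (g : E → E') (x : E) : Prop :=
  ∃ O : Set (B × Eucl c.dim), IsOpen O ∧ c.e x ∈ O ∧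
    (∀ q ∈ c.e.target ∩ O, g (c.e.symm q) ∈ c'.e.source) ∧
    SmoothFamily (c.e.target ∩ O) (fun q => (c'.e (g (c.e.symm q))).2)

theorem SmoothAt.comp {E B E' B' E'' B'' : Type} [TopologicalSpace E] [TopologicalSpace B]
    [TopologicalSpace E'] [TopologicalSpace B'] [TopologicalSpace E''] [TopologicalSpace B'']
    {p : E → B} {p' : E' → B'} {p'' : E'' → B''} {c : FiberChart p} {c' : FiberChart p'}
    {c'' : FiberChart p''} {g : E → E'} {g' : E' → E''} {f : B → B'} {x : E}
    (hf : Continuous f) (hp : ∀ x, p' (g x) = f (p x)) (hx : x ∈ c.e.source)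
    (h' : SmoothAt c' c'' g' (g x)) (h : SmoothAt c c' g x) : SmoothAt c c'' (g' ∘ g) x := by
  obtain ⟨O, hO, hxO, hm, hs⟩ := h
  obtain ⟨O', hO', hxO', hm', hs'⟩ := h'
  have hrep : ∀ q ∈ c.e.target ∩ O, c'.e (g (c.e.symm q)) =
      (f q.1, (c'.e (g (c.e.symm q))).2) := by
    intro q hq
    refine Prod.ext ?_ rfl
    rw [c'.fst_eq _ (hm q hq), hp, ← c.fst_eq _ (c.e.map_target hq.1), c.e.right_inv hq.1]
  have hcont : ContinuousOn (fun q => c'.e (g (c.e.symm q))) (c.e.target ∩ O) :=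
    ((hf.comp continuous_fst).continuousOn.prodMk hs.continuousOn).congr hrep
  obtain ⟨u, hu, hu'⟩ := continuousOn_iff'.1 hcont O' hO'
  have hsub : ∀ q ∈ c.e.target ∩ (O ∩ u), c'.e (g (c.e.symm q)) ∈ c'.e.target ∩ O' := by
    rintro q ⟨hq, hqO, hqu⟩
    have : q ∈ (fun q => c'.e (g (c.e.symm q))) ⁻¹' O' ∩ (c.e.target ∩ O) := by
      rw [hu']; exact ⟨hqu, hq, hqO⟩
    exact ⟨c'.e.map_source (hm q ⟨hq, hqO⟩), this.1⟩
  refine ⟨O ∩ u, hO.inter hu, ⟨hxO, ?_⟩, ?_, ?_⟩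
  · have : c.e x ∈ u ∩ (c.e.target ∩ O) := by
      rw [← hu']
      refine ⟨?_, c.e.map_source hx, hxO⟩
      simpa only [Set.mem_preimage, c.e.left_inv hx] using hxO'
    exact this.1
  · rintro q hq
    have h1 := hm' _ (hsub q hq)
    rwa [c'.e.left_inv (hm q ⟨hq.1, hq.2.1⟩)] at h1
  · have hs1 : SmoothFamily (c.e.target ∩ (O ∩ u)) (fun q => (c'.e (g (c.e.symm q))).2) :=
      hs.mono fun q hq => ⟨hq.1, hq.2.1⟩
    refine (hs'.comp hs1 hf ?_).congr ?_
    · intro q hq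
      rw [← hrep q ⟨hq.1, hq.2.1⟩]
      exact hsub q hq
    · intro q hq
      rw [← hrep q ⟨hq.1, hq.2.1⟩, c'.e.left_inv (hm q ⟨hq.1, hq.2.1⟩)]
      rfl

/-- `τ : U × E_b → E|U` and `ρ : E|U → E_b` form a fiberwise smooth local trivialization over
the neighborhood `U` of `b`: `(u, y) ↦ τ (u, y)` and `x ↦ (p x, ρ x)` are mutually inverse
homeomorphisms between `U × E_b` and `E|U`, both fiberwise smooth. -/
structure IsLocalTriv {E B : Type} [TopologicalSpace E] [TopologicalSpace B] (p : E → B)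
    (atlas : Set (FiberChart p)) (b : B) (U : Set B) (τ : B × E → E) (ρ : E → E) : Prop where
  isOpen : IsOpen U
  mem : b ∈ U
  continuousOn_τ : ContinuousOn τ (U ×ˢ (p ⁻¹' {b}))
  continuousOn_ρ : ContinuousOn ρ (p ⁻¹' U)
  right_inv : ∀ u ∈ U, ∀ y ∈ p ⁻¹' {b}, p (τ (u, y)) = u ∧ ρ (τ (u, y)) = y
  left_inv : ∀ x ∈ p ⁻¹' U, p (ρ x) = b ∧ τ (p x, ρ x) = x
  smooth_ρ : ∀ x ∈ p ⁻¹' U, ∀ c ∈ atlas, x ∈ c.e.source → ∀ c' ∈ atlas, ρ x ∈ c'.e.source →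
    SmoothAt c c' ρ x
  smooth_τ : ∀ x ∈ p ⁻¹' U, ∀ c ∈ atlas, x ∈ c.e.source → ∀ c' ∈ atlas, ρ x ∈ c'.e.source →
    ∃ O : Set (B × Eucl c'.dim), IsOpen O ∧ (p x, (c'.e (ρ x)).2) ∈ O ∧
      (∀ q ∈ {q : B × Eucl c'.dim | (b, q.2) ∈ c'.e.target} ∩ O,
        τ (q.1, c'.e.symm (b, q.2)) ∈ c.e.source) ∧
      SmoothFamily ({q : B × Eucl c'.dim | (b, q.2) ∈ c'.e.target} ∩ O)
        (fun q => (c.e (τ (q.1, c'.e.symm (b, q.2)))).2)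

/-- A fiberwise smooth bundle over `B`: a locally trivial bundle of compact smooth manifolds with
boundary. -/
structure SmoothBundle (B : Type) [TopologicalSpace B] where
  total : Type
  [top : TopologicalSpace total]
  [cg : CompactlyGeneratedSpace total]
  proj : C(total, B)
  atlas : Set (FiberChart proj)
  cover : ∀ x, ∃ c ∈ atlas, x ∈ c.e.source
  compat : ∀ c ∈ atlas, ∀ c' ∈ atlas, ∀ x, x ∈ c.e.source → x ∈ c'.e.source → SmoothAt c c' id x
  fiber_compact : ∀ b, IsCompact (proj ⁻¹' {b})
  fiber_t2 : ∀ b, T2Space (proj ⁻¹' {b})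
  locally_trivial : ∀ b, ∃ U τ ρ, IsLocalTriv proj atlas b U τ ρ

attribute [instance] SmoothBundle.top SmoothBundle.cg

section Bundles

variable {B B' B'' : Type} [TopologicalSpace B] [TopologicalSpace B'] [TopologicalSpace B'']

/-- The fiber `E_b`, as a subset of the total space. -/
abbrev SmoothBundle.fiber (E : SmoothBundle B) (b : B) : Set E.total := E.proj ⁻¹' {b}

/-- A fiberwise smooth map `g : E → E'` over `f : B → B'`. -/
structure IsSmoothMap (E : SmoothBundle B) (E' : SmoothBundle B') (f : B → B')
    (g : E.total → E'.total) : Prop where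
  continuous : Continuous g
  proj_eq : ∀ x, E'.proj (g x) = f (E.proj x)
  smooth : ∀ x, ∀ c ∈ E.atlas, x ∈ c.e.source → ∀ c' ∈ E'.atlas, g x ∈ c'.e.source →
    SmoothAt c c' g x

theorem IsSmoothMap.id (E : SmoothBundle B) : IsSmoothMap E E _root_.id _root_.id :=
  ⟨continuous_id, fun _ => rfl, fun x c hc hx c' hc' hx' => E.compat c hc c' hc' x hx hx'⟩

theorem IsSmoothMap.comp {E : SmoothBundle B} {E' : SmoothBundle B'} {E'' : SmoothBundle B''}
    {f : B → B'} {f' : B' → B''} {g : E.total → E'.total} {g' : E'.total → E''.total}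
    (h' : IsSmoothMap E' E'' f' g') (h : IsSmoothMap E E' f g) (hf : Continuous f) :
    IsSmoothMap E E'' (f' ∘ f) (g' ∘ g) where
  continuous := h'.continuous.comp h.continuous
  proj_eq x := by simp [h'.proj_eq, h.proj_eq]
  smooth x c hc hx c'' hc'' hx'' := by
    obtain ⟨c', hc', hx'⟩ := E'.cover (g x)
    exact (h'.smooth (g x) c' hc' hx' c'' hc'' hx'').comp hf h.proj_eq hx
      (h.smooth x c hc hx c' hc' hx')

/-- The restriction of `g` to a map of fibers `E_b → E'_{b'}` is smooth at `x ∈ E_b`. -/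
def FiberSmoothAt (E : SmoothBundle B) (E' : SmoothBundle B') (b : B) (b' : B')
    (g : E.total → E'.total) (x : E.total) : Prop :=
  ContinuousWithinAt g (E.fiber b) x ∧
  ∀ c ∈ E.atlas, x ∈ c.e.source → ∀ c' ∈ E'.atlas, g x ∈ c'.e.source →
    ContDiffWithinAt ℝ ∞ (fun y => (c'.e (g (c.e.symm (b, y)))).2)
      {y | (b, y) ∈ c.e.target} (c.e x).2

theorem IsSmoothMap.fiberSmoothAt {E : SmoothBundle B} {E' : SmoothBundle B'} {f : B → B'}
    {g : E.total → E'.total} (h : IsSmoothMap E E' f g) {b : B} {x : E.total}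
    (hx : x ∈ E.fiber b) : FiberSmoothAt E E' b (f b) g x := by
  refine ⟨h.continuous.continuousWithinAt, fun c hc hxc c' hc' hxc' => ?_⟩
  obtain ⟨O, hO, hxO, hm, hs⟩ := h.smooth x c hc hxc c' hc' hxc'
  have hb : (b, (c.e x).2) = c.e x := Prod.ext ((c.fst_eq x hxc).trans hx).symm rfl
  have h1 := hs.contDiffOn b (c.e x).2
    (show (b, (c.e x).2) ∈ c.e.target ∩ O by rw [hb]; exact ⟨c.e.map_source hxc, hxO⟩)
  refine h1.mono_of_mem_nhdsWithin ?_
  have : {y | (b, y) ∈ O} ∈ 𝓝 (c.e x).2 :=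
    (hO.preimage (Continuous.prodMk_right b)).mem_nhds (by rw [Set.mem_preimage, hb]; exact hxO)
  exact Filter.inter_mem self_mem_nhdsWithin (mem_nhdsWithin_of_mem_nhds this)

theorem FiberChart.continuousOn_slice {E : SmoothBundle B} (c : FiberChart E.proj) (b : B) :
    ContinuousOn (fun y => c.e.symm (b, y)) {y | (b, y) ∈ c.e.target} :=
  c.continuousOn_invFun.comp (Continuous.prodMk_right b).continuousOn fun _ hy => hy

theorem FiberChart.slice_mem {E : SmoothBundle B} (c : FiberChart E.proj) (b : B) {y : Eucl c.dim}
    (hy : (b, y) ∈ c.e.target) : c.e.symm (b, y) ∈ E.fiber b := by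
  change E.proj _ = b
  rw [← c.fst_eq _ (c.e.map_target hy), c.e.right_inv hy]

theorem FiberChart.mk_snd {E : SmoothBundle B} (c : FiberChart E.proj) {b : B} {x : E.total}
    (hx : x ∈ E.fiber b) (hxc : x ∈ c.e.source) : (b, (c.e x).2) = c.e x :=
  Prod.ext ((c.fst_eq x hxc).trans hx).symm rfl

theorem FiberSmoothAt.comp {E : SmoothBundle B} {E' : SmoothBundle B'} {E'' : SmoothBundle B''}
    {b : B} {b' : B'} {b'' : B''} {g : E.total → E'.total} {g' : E'.total → E''.total}
    {x : E.total} (h' : FiberSmoothAt E' E'' b' b'' g' (g x)) (h : FiberSmoothAt E E' b b' g x)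
    (hx : x ∈ E.fiber b) (hm : Set.MapsTo g (E.fiber b) (E'.fiber b')) :
    FiberSmoothAt E E'' b b'' (g' ∘ g) x := by
  refine ⟨h'.1.comp h.1 hm, fun c hc hxc c'' hc'' hxc'' => ?_⟩
  obtain ⟨c', hc', hxc'⟩ := E'.cover (g x)
  have h1 := h.2 c hc hxc c' hc' hxc'
  have h2 := h'.2 c' hc' hxc' c'' hc'' hxc''
  have hb := c.mk_snd hx hxc
  have hy0 : (c.e x).2 ∈ {y | (b, y) ∈ c.e.target} := by
    change (b, (c.e x).2) ∈ c.e.target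
    rw [hb]; exact c.e.map_source hxc
  have hx0 : c.e.symm (b, (c.e x).2) = x := by rw [hb, c.e.left_inv hxc]
  set s0 : Set (Eucl c.dim) :=
    {y | (b, y) ∈ c.e.target ∧ g (c.e.symm (b, y)) ∈ c'.e.source} with hs0
  have hnhds : s0 ∈ 𝓝[{y | (b, y) ∈ c.e.target}] (c.e x).2 := by
    have hc1 := c.continuousOn_slice b _ hy0
    have hc2 : ContinuousWithinAt g (E.fiber b) (c.e.symm (b, (c.e x).2)) := by
      rw [hx0]; exact h.1
    have hc3 := ContinuousWithinAt.comp (x := (c.e x).2) hc2 hc1 fun y hy => c.slice_mem b hy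
    have := hc3.preimage_mem_nhdsWithin (c'.open_source.mem_nhds (by
      simpa only [Function.comp, hx0] using hxc'))
    exact Filter.inter_mem self_mem_nhdsWithin this
  have hrep : ∀ y ∈ s0, (b', (c'.e (g (c.e.symm (b, y)))).2) = c'.e (g (c.e.symm (b, y))) :=
    fun y hy => c'.mk_snd (hm (c.slice_mem b hy.1)) hy.2
  have h3 : ContDiffWithinAt ℝ ∞ (fun y => (c'.e (g (c.e.symm (b, y)))).2) s0 (c.e x).2 :=
    h1.mono fun y hy => hy.1
  have h4 : ContDiffWithinAt ℝ ∞ (fun y => (c''.e (g' (c'.e.symm (b', y)))).2)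
      {y | (b', y) ∈ c'.e.target} (c'.e (g (c.e.symm (b, (c.e x).2)))).2 := by
    rw [hx0]; exact h2
  have h5 := ContDiffWithinAt.comp (c.e x).2 h4 h3 (fun y hy => by
    change (b', (c'.e (g (c.e.symm (b, y)))).2) ∈ c'.e.target
    rw [hrep y hy]; exact c'.e.map_source hy.2)
  refine (h5.mono_of_mem_nhdsWithin hnhds).congr_of_eventuallyEq ?_ ?_
  · filter_upwards [hnhds] with y hy
    simp only [Function.comp, hrep y hy, c'.e.left_inv hy.2]
  · have hy : (c.e x).2 ∈ s0 := ⟨hy0, by rw [hx0]; exact hxc'⟩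
    simp only [Function.comp, hrep _ hy, c'.e.left_inv hy.2]

/-- A fiberwise diffeomorphism `g : E → E'` over `f : B → B'`: a fiberwise smooth map that
restricts to a diffeomorphism `E_b → E'_{f b}` for each `b`. -/
structure IsFiberwiseDiffeo (E : SmoothBundle B) (E' : SmoothBundle B') (f : B → B')
    (g : E.total → E'.total) : Prop where
  smooth : IsSmoothMap E E' f g
  bijOn : ∀ b, Set.BijOn g (E.fiber b) (E'.fiber (f b))
  inverse : ∀ b, ∃ h : E'.total → E.total, ∀ x ∈ E.fiber b,
    h (g x) = x ∧ FiberSmoothAt E' E (f b) b h (g x)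

end Bundles

/-! ### Codimension zero subbundles and excision -/

/-- The coordinate whose nonpositivity cuts out a codimension zero submanifold with frontier:
`x₂` in the half space `{0 ≤ x₁}` of `ℝⁿ`, `n ≥ 2`. In `{0 ≤ x₁} ⊆ ℝ¹`, where the frontier
cannot meet the boundary, it is `x₁ - 1`; in dimension `0` there is no frontier. -/
def cut (n : ℕ) (x : Eucl n) : ℝ :=
  if h : 1 < n then x ⟨1, h⟩ else if h : 0 < n then x ⟨0, h⟩ - 1 else -1

/-- Straightening the angle: for `n ≥ 2` the homeomorphism of the quadrant
`{0 ≤ x₁, x₂ ≤ 0}` onto the half space `{0 ≤ x₁}` that doubles the polar angle in the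
`(x₁, x₂)`-plane, `(r, θ) ↦ (r, 2θ + π/2)`. In dimension `1` the reflection taking
`{x₁ ≤ 1}` to `{0 ≤ x₁}`. -/
def straighten (n : ℕ) (x : Eucl n) : Eucl n :=
  if h : 1 < n then
    let a := x ⟨0, by omega⟩
    let b := x ⟨1, h⟩
    WithLp.toLp 2 fun i =>
      if (i : ℕ) = 0 then -2 * a * b / Real.sqrt (a ^ 2 + b ^ 2)
      else if (i : ℕ) = 1 then (a ^ 2 - b ^ 2) / Real.sqrt (a ^ 2 + b ^ 2)
      else x i
  else WithLp.toLp 2 fun i => 1 - x i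

section Subbundles

variable {B B' : Type} [TopologicalSpace B] [TopologicalSpace B']

/-- A smooth chart of the manifold `E_b`: a diffeomorphism of an open subset of `E_b` onto an open
subset of the half space `{0 ≤ x₁}`. -/
structure IsFiberDiffeoChart (E : SmoothBundle B) (b : B) {n : ℕ}
    (e : PartialEquiv E.total (Eucl n)) : Prop where
  source_subset : e.source ⊆ E.fiber b
  open_source : ∃ O : Set E.total, IsOpen O ∧ e.source = O ∩ E.fiber b
  open_target : ∃ W : Set (Eucl n), IsOpen W ∧ e.target = W ∩ halfSpace n
  continuousOn_toFun : ContinuousOn e e.source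
  continuousOn_invFun : ContinuousOn e.symm e.target
  smooth_toFun : ∀ c ∈ E.atlas, ∀ x ∈ e.source, x ∈ c.e.source →
    ContDiffWithinAt ℝ ∞ (fun y => e (c.e.symm (b, y))) {y | (b, y) ∈ c.e.target} (c.e x).2
  smooth_invFun : ∀ c ∈ E.atlas, ∀ x ∈ e.source, x ∈ c.e.source →
    ContDiffWithinAt ℝ ∞ (fun y => (c.e (e.symm y)).2) e.target (e x)

/-- `g : E_b → E'_{b'}` is a diffeomorphism of a neighborhood of `x` onto a neighborhood
of `g x`. -/
def IsLocalFiberDiffeoAt (E : SmoothBundle B) (E' : SmoothBundle B') (b : B) (b' : B')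
    (g : E.total → E'.total) (x : E.total) : Prop :=
  FiberSmoothAt E E' b b' g x ∧
  ∃ h : E'.total → E.total, h (g x) = x ∧ FiberSmoothAt E' E b' b h (g x) ∧
    ∀ᶠ z in 𝓝[E'.fiber b'] (g x), h z ∈ E.fiber b ∧ g (h z) = z

/-- `M₀ < M` for `M₀ = g (E_b)` and `M = E'_{b'}`: the map `g` identifies the manifold `E_b` with
a codimension zero submanifold `M₀` of `M` whose frontier is neatly embedded. Near a frontier point
there is a chart `e'` of `M` taking `M₀` to `{cut ≤ 0}` and the closure of `M - M₀` to
`{0 ≤ cut}`, and the smooth structure of `E_b` is obtained from it by straightening the angle.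
Elsewhere `g` is a local diffeomorphism. -/
structure IsFiberLT (E : SmoothBundle B) (E' : SmoothBundle B') (b : B) (b' : B')
    (g : E.total → E'.total) : Prop where
  mapsTo : Set.MapsTo g (E.fiber b) (E'.fiber b')
  injOn : Set.InjOn g (E.fiber b)
  continuousOn : ContinuousOn g (E.fiber b)
  local_form : ∀ x ∈ E.fiber b, IsLocalFiberDiffeoAt E E' b b' g x ∨
    ∃ (n : ℕ) (e : PartialEquiv E.total (Eucl n)) (e' : PartialEquiv E'.total (Eucl n)),
      IsFiberDiffeoChart E b e ∧ IsFiberDiffeoChart E' b' e' ∧ x ∈ e.source ∧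
      e.source = E.fiber b ∩ g ⁻¹' e'.source ∧
      e' '' (e'.source ∩ g '' E.fiber b) = e'.target ∩ {y | cut n y ≤ 0} ∧
      e' '' (e'.source ∩ closure (E'.fiber b' \ g '' E.fiber b)) =
        e'.target ∩ {y | 0 ≤ cut n y} ∧
      ∀ y ∈ e.source, e y = straighten n (e' (g y))

/-- `E₀ < E₁`: the map `i` identifies `E₀` with a subbundle of `E₁` such that
`(E₀)_b < (E₁)_b` for all `b`. -/
structure IsLT (E₀ E₁ : SmoothBundle B) (i : E₀.total → E₁.total) : Prop where
  isEmbedding : IsEmbedding i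
  proj_eq : ∀ x, E₁.proj (i x) = E₀.proj x
  fiber_lt : ∀ b, IsFiberLT E₀ E₁ b b i
  locally_trivial : ∀ b, ∃ U τ₀ ρ₀ τ₁ ρ₁, IsLocalTriv E₀.proj E₀.atlas b U τ₀ ρ₀ ∧
    IsLocalTriv E₁.proj E₁.atlas b U τ₁ ρ₁ ∧
    ∀ u ∈ U, ∀ y ∈ E₀.fiber b, i (τ₀ (u, y)) = τ₁ (u, i y)

/-- The empty bundle `Φ`. -/
def emptyBundle (B : Type) [TopologicalSpace B] : SmoothBundle B where
  total := Empty
  proj := ⟨fun x => x.elim, by fun_prop⟩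
  atlas := ∅
  cover x := x.elim
  compat _ hc := hc.elim
  fiber_compact _ := (Set.toFinite _).isCompact
  fiber_t2 _ := inferInstance
  locally_trivial b := ⟨Set.univ, Prod.snd, id, isOpen_univ, Set.mem_univ _,
    continuousOn_snd, continuousOn_id, fun _ _ y => y.elim, fun x => x.elim,
    fun x => x.elim, fun x => x.elim⟩

theorem emptyBundle_isLT (E : SmoothBundle B) :
    IsLT (emptyBundle B) E (fun x : Empty => x.elim) where
  isEmbedding :=
    haveI : Subsingleton (emptyBundle B).total := inferInstanceAs (Subsingleton Empty)
    IsEmbedding.of_subsingleton _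
  proj_eq x := x.elim
  fiber_lt b := ⟨fun x => x.elim, fun x => x.elim, fun x => x.elim, fun x => x.elim⟩
  locally_trivial b := by
    obtain ⟨U, τ, ρ, h⟩ := E.locally_trivial b
    exact ⟨U, Prod.snd, id, τ, ρ, ⟨h.isOpen, h.mem, continuousOn_snd, continuousOn_id,
      fun _ _ y => y.elim, fun x => x.elim, fun x => x.elim, fun x => x.elim⟩, h,
      fun _ _ y => y.elim⟩

end Subbundles

/-- An object `(E₀ < E₁) ↓ (B, A)`. -/
structure BundlePair where
  base : CGPair
  small : SmoothBundle base.carrier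
  big : SmoothBundle base.carrier
  incl : small.total → big.total
  lt : IsLT small big incl

/-- A fiberwise smooth map `(E₀ < E₁) ↓ (B, A) → (E₀' < E₁') ↓ (B', A')`. -/
@[ext]
structure BundlePair.Hom (X Y : BundlePair) where
  base : X.base ⟶ Y.base
  small : X.small.total → Y.small.total
  big : X.big.total → Y.big.total
  smooth_small : IsSmoothMap X.small Y.small base.toMap small
  smooth_big : IsSmoothMap X.big Y.big base.toMap big
  comm : ∀ x, big (X.incl x) = Y.incl (small x)

instance : Category BundlePair where
  Hom := BundlePair.Hom
  id X := ⟨𝟙 _, id, id, IsSmoothMap.id _, IsSmoothMap.id _, fun _ => rfl⟩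
  comp f g := ⟨f.base ≫ g.base, g.small ∘ f.small, g.big ∘ f.big,
    g.smooth_small.comp f.smooth_small f.base.toMap.continuous,
    g.smooth_big.comp f.smooth_big f.base.toMap.continuous,
    fun x => by simp [f.comm, g.comm]⟩

/-- The pair `(E, E↓A)` for a bundle `E` over `(B, A)`. -/
def totalPair (P : CGPair) (E : SmoothBundle P.carrier) : CGPair where
  carrier := E.total
  sub := E.proj ⁻¹' P.sub
  isClosed_sub := P.isClosed_sub.preimage E.proj.continuous

/-- The functor `(E₀ < E₁) ↓ (B, A) ↦ (B, A)`. -/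
def baseFunctor : BundlePair ⥤ CGPair where
  obj X := X.base
  map f := f.base

/-- The map of pairs `(E, E↓A) → (E', E'↓A')` given by a map `g` over `f : (B, A) → (B', A')`. -/
def totalMap {P P' : CGPair} (E : SmoothBundle P.carrier) (E' : SmoothBundle P'.carrier)
    (f : P ⟶ P') (g : E.total → E'.total) (hg : Continuous g)
    (hp : ∀ x, E'.proj (g x) = f.toMap (E.proj x)) : totalPair P E ⟶ totalPair P' E' where
  toMap := ⟨g, hg⟩
  mapsTo x hx := (congrArg (· ∈ P'.sub) (hp x)).mpr (f.mapsTo _ hx)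

/-- The functor `(E₀ < E₁) ↓ (B, A) ↦ (E₁, E₁↓A)`. -/
def totalFunctor : BundlePair ⥤ CGPair where
  obj X := totalPair X.base X.big
  map f := totalMap _ _ f.base f.big f.smooth_big.continuous f.smooth_big.proj_eq

/-- The map `f : (E₀ < E₁) → (E₀' < E₁')` is an excision: on each fiber it is an embedding, the
square with rows `E₀ < E₁`, `E₀' < E₁'` and columns given by `f` is regular, and
`f(E₀) = f(E₁) ∩ E₀'`, `E₁' = f(E₁) ∪ E₀'`. -/
def IsExcision {X Y : BundlePair} (f : X ⟶ Y) : Prop :=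
  ∀ b : X.base.carrier,
    IsFiberLT X.small Y.small b (f.base.toMap b) f.small ∧
    IsFiberLT X.big Y.big b (f.base.toMap b) f.big ∧
    IsFiberLT X.small Y.big b (f.base.toMap b) (f.big ∘ X.incl) ∧
    f.big '' (X.incl '' X.small.fiber b) =
      f.big '' X.big.fiber b ∩ Y.incl '' Y.small.fiber (f.base.toMap b) ∧
    Y.big.fiber (f.base.toMap b) =
      f.big '' X.big.fiber b ∪ Y.incl '' Y.small.fiber (f.base.toMap b)

/-- A simplex `X₀ → ⋯ → X_q` of the nerve is excisive if all the maps `X_j → X_k`, `j ≤ k`, are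
excisions. -/
def ExcisiveSimplex {q : ℕ} (C : ComposableArrows BundlePair q) : Prop :=
  ∀ j k : Fin (q + 1), ∀ h : j ≤ k, IsExcision (C.map (homOfLE h))

/-- The absolute bundle `E ↓ (B, A)`, that is, `(Φ < E) ↓ (B, A)`. -/
def BundlePair.abs (P : CGPair) (E : SmoothBundle P.carrier) : BundlePair where
  base := P
  small := emptyBundle _
  big := E
  incl := fun x : Empty => x.elim
  lt := emptyBundle_isLT E

/-- The map `(Φ < E) → (Φ < E')` given by a fiberwise smooth map `E → E'`. -/
def BundlePair.absMap {P P' : CGPair} {E : SmoothBundle P.carrier} {E' : SmoothBundle P'.carrier}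
    (f : P ⟶ P') (g : E.total → E'.total) (hg : IsSmoothMap E E' f.toMap g) :
    BundlePair.abs P E ⟶ BundlePair.abs P' E' where
  base := f
  small := fun x : Empty => x
  big := g
  smooth_small := ⟨continuous_id (X := Empty), fun x => Empty.elim x, fun x => Empty.elim x⟩
  smooth_big := hg
  comm x := Empty.elim x

theorem IsFiberwiseDiffeo.isFiberLT {B B' : Type} [TopologicalSpace B] [TopologicalSpace B']
    {E : SmoothBundle B} {E' : SmoothBundle B'} {f : B → B'} {g : E.total → E'.total}
    (h : IsFiberwiseDiffeo E E' f g) (b : B) : IsFiberLT E E' b (f b) g where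
  mapsTo := (h.bijOn b).mapsTo
  injOn := (h.bijOn b).injOn
  continuousOn := h.smooth.continuous.continuousOn
  local_form x hx := by
    left
    obtain ⟨k, hk⟩ := h.inverse b
    refine ⟨h.smooth.fiberSmoothAt hx, k, (hk x hx).1, (hk x hx).2, ?_⟩
    filter_upwards [self_mem_nhdsWithin] with z hz
    obtain ⟨y, hy, rfl⟩ := (h.bijOn b).surjOn hz
    rw [(hk y hy).1]
    exact ⟨hy, rfl⟩

theorem IsFiberwiseDiffeo.id {B : Type} [TopologicalSpace B] (E : SmoothBundle B) :
    IsFiberwiseDiffeo E E _root_.id _root_.id where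
  smooth := IsSmoothMap.id E
  bijOn b := Set.bijOn_id _
  inverse b := ⟨_root_.id, fun x hx => ⟨rfl, (IsSmoothMap.id E).fiberSmoothAt hx⟩⟩

theorem IsFiberwiseDiffeo.comp {B B' B'' : Type} [TopologicalSpace B] [TopologicalSpace B']
    [TopologicalSpace B''] {E : SmoothBundle B} {E' : SmoothBundle B'} {E'' : SmoothBundle B''}
    {f : B → B'} {f' : B' → B''} {g : E.total → E'.total} {g' : E'.total → E''.total}
    (h' : IsFiberwiseDiffeo E' E'' f' g') (h : IsFiberwiseDiffeo E E' f g) (hf : Continuous f) :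
    IsFiberwiseDiffeo E E'' (f' ∘ f) (g' ∘ g) where
  smooth := h'.smooth.comp h.smooth hf
  bijOn b := (h'.bijOn (f b)).comp (h.bijOn b)
  inverse b := by
    obtain ⟨k, hk⟩ := h.inverse b
    obtain ⟨k', hk'⟩ := h'.inverse (f b)
    refine ⟨k ∘ k', fun x hx => ?_⟩
    have hgx := (h.bijOn b).mapsTo hx
    have e1 := (hk' _ hgx).1
    refine ⟨by simp [e1, (hk x hx).1], ?_⟩
    refine FiberSmoothAt.comp (b' := f b) ?_ (hk' _ hgx).2 ((h'.bijOn (f b)).mapsTo hgx) ?_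
    · simp only [Function.comp, e1]; exact (hk x hx).2
    · intro z hz
      obtain ⟨y, hy, rfl⟩ := (h'.bijOn (f b)).surjOn hz
      rw [(hk' y hy).1]; exact hy

theorem IsFiberwiseDiffeo.isExcision {P P' : CGPair} {E : SmoothBundle P.carrier}
    {E' : SmoothBundle P'.carrier} {f : P ⟶ P'} {g : E.total → E'.total}
    (h : IsFiberwiseDiffeo E E' f.toMap g) : IsExcision (BundlePair.absMap f g h.smooth) := by
  intro b
  refine ⟨⟨fun x => Empty.elim x, fun x => Empty.elim x, fun x => Empty.elim x,
    fun x => Empty.elim x⟩, h.isFiberLT b, ⟨fun x => Empty.elim x, fun x => Empty.elim x,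
    fun x => Empty.elim x, fun x => Empty.elim x⟩, ?_, ?_⟩
  · ext z
    constructor
    · rintro ⟨_, ⟨x, _, _⟩, _⟩
      exact Empty.elim x
    · rintro ⟨_, ⟨x, _, _⟩⟩
      exact Empty.elim x
  · ext z
    constructor
    · intro hz
      exact Or.inl ((h.bijOn b).surjOn hz)
    · rintro (⟨x, hx, rfl⟩ | ⟨x, _, _⟩)
      · exact (h.bijOn b).mapsTo hx
      · exact Empty.elim x

/-! ### Disk bundles with section -/

/-- The fiberwise interior `E - Ė`. -/
def SmoothBundle.interior {B : Type} [TopologicalSpace B] (E : SmoothBundle B) : Set E.total :=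
  {x | ∃ c ∈ E.atlas, x ∈ c.e.source ∧ ∀ h : 0 < c.dim, 0 < (c.e x).2 ⟨0, h⟩}

/-- `E` is fiberwise diffeomorphic to an orthogonal disk bundle: there are an open cover `U_i` of
the base and fiberwise diffeomorphisms `ψ_i : U_i × Dⁿ → E|U_i`, with inverse `(p, θ_i)`, whose
transition maps are orthogonal on each fiber. -/
def IsDiskBundle {B : Type} [TopologicalSpace B] (E : SmoothBundle B) : Prop :=
  ∃ (ι : Type) (U : ι → Set B) (n : ι → ℕ) (ψ : ∀ i, B × Eucl (n i) → E.total)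
    (θ : ∀ i, E.total → Eucl (n i)),
    (∀ b, ∃ i, b ∈ U i) ∧
    (∀ i, IsOpen (U i) ∧
      ContinuousOn (ψ i) (U i ×ˢ Metric.closedBall 0 1) ∧
      ContinuousOn (θ i) (E.proj ⁻¹' U i) ∧
      (∀ b ∈ U i, ∀ v ∈ Metric.closedBall (0 : Eucl (n i)) 1,
        E.proj (ψ i (b, v)) = b ∧ θ i (ψ i (b, v)) = v) ∧
      (∀ x ∈ E.proj ⁻¹' U i, θ i x ∈ Metric.closedBall (0 : Eucl (n i)) 1 ∧
        ψ i (E.proj x, θ i x) = x) ∧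
      ∀ x ∈ E.proj ⁻¹' U i, ∀ c ∈ E.atlas, x ∈ c.e.source →
        (∃ O : Set (B × Eucl c.dim), IsOpen O ∧ c.e x ∈ O ∧
          SmoothFamily (c.e.target ∩ O) (fun q => θ i (c.e.symm q))) ∧
        ∃ O : Set (B × Eucl (n i)), IsOpen O ∧ (E.proj x, θ i x) ∈ O ∧
          (∀ q ∈ {q : B × Eucl (n i) | q.2 ∈ Metric.closedBall 0 1} ∩ O, ψ i q ∈ c.e.source) ∧
          SmoothFamily ({q : B × Eucl (n i) | q.2 ∈ Metric.closedBall 0 1} ∩ O)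
            (fun q => (c.e (ψ i q)).2)) ∧
    ∀ i j, ∀ b ∈ U i ∩ U j, ∃ A : Eucl (n i) ≃ₗᵢ[ℝ] Eucl (n j),
      ∀ v ∈ Metric.closedBall (0 : Eucl (n i)) 1, ψ j (b, A v) = ψ i (b, v)

/-- The bundle `E` is diffeomorphic to an orthogonal disk bundle, and `Δ : B → E - Ė` is a
section. -/
structure DiskSection {P : CGPair} (E : SmoothBundle P.carrier) where
  isDisk : IsDiskBundle E
  sec : C(P.carrier, E.total)
  proj_sec : ∀ b, E.proj (sec b) = b
  sec_interior : ∀ b, sec b ∈ E.interior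

/-- An object `(E ↓ (B, A), Δ)`. -/
structure DiskPair where
  base : CGPair
  bundle : SmoothBundle base.carrier
  disk : DiskSection bundle

/-- The section `Δ`. -/
abbrev DiskPair.sec (X : DiskPair) : C(X.base.carrier, X.bundle.total) := X.disk.sec

/-- A fiberwise diffeomorphism that preserves the sections. -/
@[ext]
structure DiskPair.Hom (X Y : DiskPair) where
  base : X.base ⟶ Y.base
  total : X.bundle.total → Y.bundle.total
  diffeo : IsFiberwiseDiffeo X.bundle Y.bundle base.toMap total
  total_sec : ∀ b, total (X.sec b) = Y.sec (base.toMap b)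

instance : Category DiskPair where
  Hom := DiskPair.Hom
  id X := ⟨𝟙 _, id, IsFiberwiseDiffeo.id _, fun _ => rfl⟩
  comp f g := ⟨f.base ≫ g.base, g.total ∘ f.total, g.diffeo.comp f.diffeo f.base.toMap.continuous,
    fun b => by
      change g.total (f.total _) = _
      rw [f.total_sec, g.total_sec]; rfl⟩

/-- The functor `(E, Δ) ↦ (Φ < E)`. -/
def diskFunctor : DiskPair ⥤ BundlePair where
  obj X := BundlePair.abs X.base X.bundle
  map f := BundlePair.absMap f.base f.total f.diffeo.smooth

theorem excisiveSimplex_disk {p : ℕ} (C : ComposableArrows DiskPair p) :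
    ExcisiveSimplex (C ⋙ diskFunctor : ComposableArrows BundlePair p) :=
  fun j k h => (C.map (homOfLE h)).diffeo.isExcision

/-- The section as a map of pairs `Δ : (B, A) → (E, E↓A)`. -/
def DiskPair.secMap (X : DiskPair) : X.base ⟶ totalPair X.base X.bundle where
  toMap := X.sec
  mapsTo b hb := by
    change X.bundle.proj (X.sec b) ∈ X.base.sub
    rwa [X.disk.proj_sec]

/-- `d(E, Δ) = F(Δ) ε(B, A) : L(B, A) → F(E, E↓A)`. -/
def DiskPair.d (M : MultFunctor) (X : DiskPair) :
    L.obj X.base ⟶ M.F.obj (totalPair X.base X.bundle) :=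
  M.eps.app X.base ≫ M.F.map X.secMap

/-! ### Transfer -/

namespace MultFunctor

theorem iota_end (v : I) (j : Fin 2) (hv : stdSimplex.map (OrderHom.const (Fin 1) j)
    (default : stdSimplex ℝ (Fin 1)) = stdSimplexHomeomorphUnitInterval.symm v) :
    ∃ z : SingReal PUnit, iota v =
      (L.map (⟨ContinuousMap.const _ v, fun _ h => h⟩ : CGPair.ofSpace PUnit ⟶ Ipair)).toMap
        (LMk _ z) := by
  refine ⟨charMap (ContinuousMap.const (stdSimplex ℝ (Fin 1)) PUnit.unit) default, ?_⟩
  refine congrArg (LMk Ipair) ?_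
  rw [← hv, charMap_comp]
  refine Eq.trans ?_ (charMap_map (ContinuousMap.const (stdSimplex ℝ (Fin 1)) PUnit.unit)
    (ContinuousMap.const _ v : C(PUnit, I)) default).symm
  congr 1
  congr 1
  ext t
  have ht : t = default := Subsingleton.elim _ _
  have : stdSimplexHomeomorphUnitInterval (stdSimplex.map (OrderHom.const (Fin 1) j) t) = v := by
    rw [ht, hv, Homeomorph.apply_symm_apply]
  exact congrArg Subtype.val this

theorem hat_end (M : MultFunctor) {X Y : CGPair} (h : X.prod Ipair ⟶ Y) (g : X ⟶ Y) (v : I)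
    (j : Fin 2) (hv : stdSimplex.map (OrderHom.const (Fin 1) j)
      (default : stdSimplex ℝ (Fin 1)) = stdSimplexHomeomorphUnitInterval.symm v)
    (hg : ∀ x, h.toMap (KProd.mk x v) = g.toMap x) (x : (M.F.obj X).carrier) :
    M.hat h (x, v) = (M.F.map g).toMap x := by
  obtain ⟨z, hz⟩ := iota_end v j hv
  have h1 := M.omega_natural (𝟙 X)
    (⟨ContinuousMap.const _ v, fun _ h => h⟩ : CGPair.ofSpace PUnit ⟶ Ipair) x (LMk _ z)
  have hid : (M.F.map (𝟙 X)).toMap x = x := by rw [M.F.map_id]; rfl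
  rw [hid, ← hz] at h1
  have h2 : CGPair.prodMap (𝟙 X)
      (⟨ContinuousMap.const _ v, fun _ h => h⟩ : CGPair.ofSpace PUnit ⟶ Ipair) ≫ h =
      X.prodPoint ≫ g := by
    refine CGPair.Hom.ext (ContinuousMap.ext fun q => ?_)
    exact hg q.1
  have h3 : ∀ y, (M.F.map h).toMap ((M.F.map (CGPair.prodMap (𝟙 X)
      (⟨ContinuousMap.const _ v, fun _ h => h⟩ : CGPair.ofSpace PUnit ⟶ Ipair))).toMap y) =
      (M.F.map g).toMap ((M.F.map X.prodPoint).toMap y) := by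
    intro y
    have e := congrArg (fun k => (PtdTop.Hom.toMap k) y) (congrArg M.F.map h2)
    rw [M.F.map_comp, M.F.map_comp] at e
    exact e
  refine (congrArg (M.F.map h).toMap h1).trans ((h3 _).trans ?_)
  exact congrArg (M.F.map g).toMap (M.omega_point X x z)

theorem hat_zero (M : MultFunctor) {X Y : CGPair} (h : X.prod Ipair ⟶ Y) (g : X ⟶ Y)
    (hg : ∀ x, h.toMap (KProd.mk x (0 : I)) = g.toMap x) (x : (M.F.obj X).carrier) :
    M.hat h (x, 0) = (M.F.map g).toMap x :=
  M.hat_end h g 0 0 (SimplicialTransformation.map_const_zero _) hg x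

theorem hat_one (M : MultFunctor) {X Y : CGPair} (h : X.prod Ipair ⟶ Y) (g : X ⟶ Y)
    (hg : ∀ x, h.toMap (KProd.mk x (1 : I)) = g.toMap x) (x : (M.F.obj X).carrier) :
    M.hat h (x, 1) = (M.F.map g).toMap x :=
  M.hat_end h g 1 1 (SimplicialTransformation.map_const_one _) hg x

theorem hat_pt (M : MultFunctor) {X Y : CGPair} (h : X.prod Ipair ⟶ Y) (v : I) :
    M.hat h ((M.F.obj X).pt, v) = (M.F.obj Y).pt :=
  (congrArg (M.F.map h).toMap (M.omega_pt_left X Ipair (iota v))).trans (M.F.map h).map_pt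

end MultFunctor

/-- A transfer for `F`, as far as it concerns single inclusions `E₀ < E₁` and disk bundles: a
simplicial transformation `T : L → F` on the excisive simplices, and on the category of disk
bundles with section a simplicial homotopy `d : L ∧ I⁺ → F`, with `d₀ = T` and
`d₁ = d(E, Δ) = F(Δ) ε`. -/
structure Transfer (M : MultFunctor) where
  T : SimplicialTransformation ExcisiveSimplex (baseFunctor ⋙ L) (totalFunctor ⋙ M.F) PUnit
  d : SimplicialTransformation (fun _ => True) (diskFunctor ⋙ baseFunctor ⋙ L)
    (diskFunctor ⋙ totalFunctor ⋙ M.F) I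
  d_zero : ∀ {p : ℕ} (C : ComposableArrows DiskPair p) (x : (L.obj (C.obj 0).base).carrier)
    (t : stdSimplex ℝ (Fin (p + 1))),
    d.app C trivial (x, 0, t) =
      T.app (C ⋙ diskFunctor : ComposableArrows BundlePair p) (excisiveSimplex_disk C)
        (x, PUnit.unit, t)
  d_one : ∀ {p : ℕ} (C : ComposableArrows DiskPair p) (x : (L.obj (C.obj 0).base).carrier)
    (t : stdSimplex ℝ (Fin (p + 1))),
    d.app C trivial (x, 1, t) =
      ((C.obj (Fin.last p)).d M).toMap
        ((L.map (C.map (homOfLE (Fin.zero_le (Fin.last p)))).base).toMap x)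

theorem excisiveSimplex_abs (P : CGPair) (E : SmoothBundle P.carrier) :
    ExcisiveSimplex (ComposableArrows.mk₀ (BundlePair.abs P E)) := fun _ _ _ =>
  (IsFiberwiseDiffeo.id E).isExcision (f := 𝟙 P)

theorem excisiveSimplex_absMap {P : CGPair} {E E' : SmoothBundle P.carrier}
    {g : E.total → E'.total} (h : IsFiberwiseDiffeo E E' (𝟙 P : P ⟶ P).toMap g) :
    ExcisiveSimplex (ComposableArrows.mk₁ (BundlePair.absMap (𝟙 P) g h.smooth)) := by
  intro j k hjk
  fin_cases j <;> fin_cases k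
  · exact (IsFiberwiseDiffeo.id E).isExcision (f := 𝟙 P)
  · exact h.isExcision
  · exact absurd hjk (by decide)
  · exact (IsFiberwiseDiffeo.id E').isExcision (f := 𝟙 P)

/-- The map `F(g) : F(E, E↓A) → F(E', E'↓A)` for a map `g : E → E'` over `(B, A)`. -/
def MultFunctor.map (M : MultFunctor) {P : CGPair} {E E' : SmoothBundle P.carrier}
    (g : E.total → E'.total) (hg : Continuous g) (hp : ∀ x, E'.proj (g x) = E.proj x) :
    C((M.F.obj (totalPair P E)).carrier, (M.F.obj (totalPair P E')).carrier) :=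
  (M.F.map (totalMap E E' (𝟙 P) g hg hp)).toMap

theorem MultFunctor.map_map (M : MultFunctor) {P : CGPair} {E E' E'' : SmoothBundle P.carrier}
    {g : E.total → E'.total} {hg : Continuous g} {hp : ∀ x, E'.proj (g x) = E.proj x}
    {g' : E'.total → E''.total} {hg' : Continuous g'} {hp' : ∀ x, E''.proj (g' x) = E'.proj x}
    (hg'' : Continuous (g' ∘ g)) (hp'' : ∀ x, E''.proj ((g' ∘ g) x) = E.proj x)
    (x : (M.F.obj (totalPair P E)).carrier) :
    M.map g' hg' hp' (M.map g hg hp x) = M.map (g' ∘ g) hg'' hp'' x := by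
  have e : totalMap E E' (𝟙 P) g hg hp ≫ totalMap E' E'' (𝟙 P) g' hg' hp' =
      totalMap E E'' (𝟙 P) (g' ∘ g) hg'' hp'' := rfl
  have h := congrArg (fun k => (PtdTop.Hom.toMap k) x) (congrArg M.F.map e)
  rw [M.F.map_comp] at h
  exact h

/-- The map `T(E) = T(Φ < E) : L(B, A) → F(E, E↓A)`. -/
def Transfer.abs {M : MultFunctor} (T : Transfer M) {P : CGPair} (E : SmoothBundle P.carrier) :
    C((L.obj P).carrier, (M.F.obj (totalPair P E)).carrier) :=
  ⟨fun x => T.T.app (ComposableArrows.mk₀ (BundlePair.abs P E)) (excisiveSimplex_abs P E)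
      (x, PUnit.unit, default),
    (T.T.app (ComposableArrows.mk₀ (BundlePair.abs P E)) (excisiveSimplex_abs P E)).continuous.comp
      (Continuous.prodMk_left _)⟩

theorem Transfer.abs_pt {M : MultFunctor} (T : Transfer M) {P : CGPair}
    (E : SmoothBundle P.carrier) :
    T.abs E (L.obj P).pt = (M.F.obj (totalPair P E)).pt :=
  T.T.app_pt (ComposableArrows.mk₀ (BundlePair.abs P E)) (excisiveSimplex_abs P E)
    PUnit.unit default

/-- An expansion `(φ, λ) : E₀ → E₁`, where `E₀ < E₁` by means of `i`: a fiberwise diffeomorphism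
`φ : E₀ → E₁` and a map `λ : E₀ × I → E₁` over `B` with `λ₀ = i` and `λ₁ = φ`. -/
structure Expansion {P : CGPair} (E₀ E₁ : SmoothBundle P.carrier) (i : E₀.total → E₁.total) where
  lt : IsLT E₀ E₁ i
  φ : E₀.total → E₁.total
  diffeo : IsFiberwiseDiffeo E₀ E₁ (𝟙 P : P ⟶ P).toMap φ
  lam : C(E₀.total × I, E₁.total)
  proj_lam : ∀ x t, E₁.proj (lam (x, t)) = E₀.proj x
  lam_zero : ∀ x, lam (x, 0) = i x
  lam_one : ∀ x, lam (x, 1) = φ x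

namespace Expansion

variable {P : CGPair} {E₀ E₁ E₂ : SmoothBundle P.carrier} {i : E₀.total → E₁.total}
  {i' : E₁.total → E₂.total}

/-- The composite expansion: `φ₀₂ = φ₁₂ φ₀₁` and `(λ₀₂)_t = (λ₁₂)_t (λ₀₁)_t`. -/
def comp (X : Expansion E₀ E₁ i) (X' : Expansion E₁ E₂ i') (h : IsLT E₀ E₂ (i' ∘ i)) :
    Expansion E₀ E₂ (i' ∘ i) where
  lt := h
  φ := X'.φ ∘ X.φ
  diffeo := X'.diffeo.comp X.diffeo (𝟙 P : P ⟶ P).toMap.continuous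
  lam := ⟨fun q => X'.lam (X.lam q, q.2), by fun_prop⟩
  proj_lam x t := (X'.proj_lam _ t).trans (X.proj_lam x t)
  lam_zero x := by simp [X.lam_zero, X'.lam_zero]
  lam_one x := by simp [X.lam_one, X'.lam_one]

/-- `λ` as a map of pairs `(E₀, E₀↓A) × I → (E₁, E₁↓A)`. -/
def lamMap (X : Expansion E₀ E₁ i) : (totalPair P E₀).prod Ipair ⟶ totalPair P E₁ where
  toMap := ⟨fun q => X.lam (q.1, q.2), KProd.continuous_of_prod _ X.lam.continuous⟩
  mapsTo := by
    rintro q (h | h)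
    · exact h.elim
    · exact (congrArg (· ∈ P.sub) (X.proj_lam q.1 q.2)).mpr h

/-- `F(i) : F(E₀, E₀↓A) → F(E₁, E₁↓A)`. -/
def mapIncl (X : Expansion E₀ E₁ i) (M : MultFunctor) :
    C((M.F.obj (totalPair P E₀)).carrier, (M.F.obj (totalPair P E₁)).carrier) :=
  M.map i X.lt.isEmbedding.continuous X.lt.proj_eq

/-- `F(φ) : F(E₀, E₀↓A) → F(E₁, E₁↓A)`. -/
def mapPhi (X : Expansion E₀ E₁ i) (M : MultFunctor) :
    C((M.F.obj (totalPair P E₀)).carrier, (M.F.obj (totalPair P E₁)).carrier) :=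
  M.map X.φ X.diffeo.smooth.continuous X.diffeo.smooth.proj_eq

variable {M : MultFunctor}

/-- The homotopy `F̂(λ)(T(E₀) ∧ 1) : F(i) T(E₀) ∼ F(φ) T(E₀)`. -/
def c₁ (X : Expansion E₀ E₁ i) (T : Transfer M) :
    ContinuousMap.HomotopyRel ((X.mapIncl M).comp (T.abs E₀)) ((X.mapPhi M).comp (T.abs E₀))
      {(L.obj P).pt} where
  toFun q := M.hat X.lamMap (T.abs E₀ q.2, q.1)
  continuous_toFun := by fun_prop
  map_zero_left x := M.hat_zero X.lamMap (totalMap E₀ E₁ (𝟙 P) i X.lt.isEmbedding.continuous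
    X.lt.proj_eq) X.lam_zero _
  map_one_left x := M.hat_one X.lamMap (totalMap E₀ E₁ (𝟙 P) X.φ X.diffeo.smooth.continuous
    X.diffeo.smooth.proj_eq) X.lam_one _
  prop' t x hx := by
    obtain rfl : x = (L.obj P).pt := hx
    have h1 := T.abs_pt E₀
    refine ((congrArg (fun y => M.hat X.lamMap (y, t)) h1).trans (M.hat_pt X.lamMap t)).trans ?_
    refine Eq.symm ((congrArg (X.mapIncl M) h1).trans ?_)
    exact (M.F.map _).map_pt

/-- The homotopy `T(φ) : F(φ) T(E₀) ∼ T(E₁)`. -/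
def c₂ (X : Expansion E₀ E₁ i) (T : Transfer M) :
    ContinuousMap.HomotopyRel ((X.mapPhi M).comp (T.abs E₀)) (T.abs E₁) {(L.obj P).pt} where
  toFun q := T.T.app (ComposableArrows.mk₁ (BundlePair.absMap (𝟙 P) X.φ X.diffeo.smooth))
    (excisiveSimplex_absMap X.diffeo)
    (q.2, PUnit.unit, stdSimplexHomeomorphUnitInterval.symm q.1)
  continuous_toFun := (T.T.app _ _).continuous.comp (continuous_snd.prodMk
    (continuous_const.prodMk
      (stdSimplexHomeomorphUnitInterval.symm.continuous.comp continuous_fst)))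
  map_zero_left x := T.T.app_mk₁_zero (BundlePair.absMap (𝟙 P) X.φ X.diffeo.smooth)
    (excisiveSimplex_absMap X.diffeo) (excisiveSimplex_abs P E₀) x PUnit.unit
  map_one_left x := by
    refine (T.T.app_mk₁_one (BundlePair.absMap (𝟙 P) X.φ X.diffeo.smooth)
      (excisiveSimplex_absMap X.diffeo) (excisiveSimplex_abs P E₁) x PUnit.unit).trans ?_
    have hid : (L.map (𝟙 P)).toMap x = x := by rw [L.map_id]; rfl
    exact congrArg (T.abs E₁) hid
  prop' t x hx := by
    obtain rfl : x = (L.obj P).pt := hx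
    have h1 := T.abs_pt E₀
    refine (T.T.app_pt _ _ _ _).trans (Eq.symm ((congrArg (X.mapPhi M) h1).trans ?_))
    exact (M.F.map _).map_pt

/-- The path `c(φ, λ) : F(i) T(E₀) ∼ T(E₁)`: the path `F̂(λ)(T(E₀) ∧ 1)` followed
by `T(φ)`. -/
def c (X : Expansion E₀ E₁ i) (T : Transfer M) :
    ContinuousMap.HomotopyRel ((X.mapIncl M).comp (T.abs E₀)) (T.abs E₁) {(L.obj P).pt} :=
  (X.c₁ T).trans (X.c₂ T)

end Expansion

theorem DiskPair.d_app {M : MultFunctor} (T : Transfer M) (X : DiskPair)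
    (x : (L.obj X.base).carrier) :
    T.d.app (ComposableArrows.mk₀ X) trivial (x, 1, default) = (X.d M).toMap x := by
  refine (T.d_one (ComposableArrows.mk₀ X) x default).trans ?_
  have hid : (L.map (𝟙 X.base)).toMap x = x := by rw [L.map_id]; rfl
  exact congrArg (X.d M).toMap hid

/-- The path `d(E, Δ) : F(Δ) ε(B, A) ∼ T(E)`. -/
def Transfer.dPath {M : MultFunctor} (T : Transfer M) (X : DiskPair) :
    ContinuousMap.HomotopyRel (X.d M).toMap (T.abs X.bundle) {(L.obj X.base).pt} where
  toFun q := T.d.app (ComposableArrows.mk₀ X) trivial (q.2, unitInterval.symm q.1, default)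
  continuous_toFun := (T.d.app (ComposableArrows.mk₀ X) trivial).continuous.comp
    (continuous_snd.prodMk ((unitInterval.continuous_symm.comp continuous_fst).prodMk
      continuous_const))
  map_zero_left x := (congrArg (fun s => T.d.app (ComposableArrows.mk₀ X) trivial (x, s, default))
    unitInterval.symm_zero).trans (X.d_app T x)
  map_one_left x := (congrArg (fun s => T.d.app (ComposableArrows.mk₀ X) trivial (x, s, default))
    unitInterval.symm_one).trans (T.d_zero (ComposableArrows.mk₀ X) x default)
  prop' t x hx := by
    obtain rfl : x = (L.obj X.base).pt := hx
    exact (T.d.app_pt (ComposableArrows.mk₀ X) trivial _ _).trans (X.d M).map_pt.symm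

/-- Two paths between the pointed maps `f` and `g` are homotopic rel. `∂I`, through paths of
pointed maps. -/
def PathHomotopic {X Y : PtdTop} {f g : C(X.carrier, Y.carrier)}
    (H H' : ContinuousMap.HomotopyRel f g {X.pt}) : Prop :=
  ContinuousMap.HomotopicRel H.toContinuousMap H'.toContinuousMap
    {q : I × X.carrier | q.1 = 0 ∨ q.1 = 1 ∨ q.2 = X.pt}

namespace Expansion

variable {P : CGPair} {E₀ E₁ E₂ : SmoothBundle P.carrier} {i : E₀.total → E₁.total}
  {i' : E₁.total → E₂.total} {M : MultFunctor}

theorem mapIncl_comp (X : Expansion E₀ E₁ i) (X' : Expansion E₁ E₂ i')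
    (h : IsLT E₀ E₂ (i' ∘ i)) (T : Transfer M) :
    (X'.mapIncl M).comp ((X.mapIncl M).comp (T.abs E₀)) =
      ((X.comp X' h).mapIncl M).comp (T.abs E₀) :=
  ContinuousMap.ext fun _ => M.map_map _ _ _

theorem mapIncl_image_pt (X : Expansion E₀ E₁ i) :
    X.mapIncl M (M.F.obj (totalPair P E₀)).pt = (M.F.obj (totalPair P E₁)).pt :=
  (M.F.map _).map_pt

/-- The path `c(φ₁₂, λ₁₂) · F(i₁₂) c(φ₀₁, λ₀₁) : F(i₀₂) T(E₀) ∼ T(E₂)`, that is,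
`F(i₁₂) c(φ₀₁, λ₀₁) : F(i₁₂) F(i₀₁) T(E₀) ∼ F(i₁₂) T(E₁)` followed by
`c(φ₁₂, λ₁₂) : F(i₁₂) T(E₁) ∼ T(E₂)`. -/
def cc (X : Expansion E₀ E₁ i) (X' : Expansion E₁ E₂ i') (h : IsLT E₀ E₂ (i' ∘ i))
    (T : Transfer M) :
    ContinuousMap.HomotopyRel (((X.comp X' h).mapIncl M).comp (T.abs E₀)) (T.abs E₂)
      {(L.obj P).pt} :=
  (((X.c T).compContinuousMap (X'.mapIncl M)).cast (mapIncl_comp X X' h T) rfl).trans (X'.c T)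

theorem mapIncl_d (X : Expansion E₀ E₁ i) (D₀ : DiskSection E₀) (D₁ : DiskSection E₁)
    (hi : ∀ b, i (D₀.sec b) = D₁.sec b) :
    (X.mapIncl M).comp (DiskPair.d M ⟨P, E₀, D₀⟩).toMap = (DiskPair.d M ⟨P, E₁, D₁⟩).toMap := by
  have e : DiskPair.secMap ⟨P, E₀, D₀⟩ ≫
      totalMap E₀ E₁ (𝟙 P) i X.lt.isEmbedding.continuous X.lt.proj_eq =
      DiskPair.secMap ⟨P, E₁, D₁⟩ := CGPair.Hom.ext (ContinuousMap.ext hi)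
  refine ContinuousMap.ext fun x => ?_
  have h := congrArg (fun k => (PtdTop.Hom.toMap k) ((M.eps.app P).toMap x)) (congrArg M.F.map e)
  rw [M.F.map_comp] at h
  exact h

/-- The path `d(E₁, Δ₁) · F(i) d(E₀, Δ₀)⁻¹ : F(i) T(E₀) ∼ T(E₁)`, that is,
`F(i) d(E₀, Δ₀)⁻¹ : F(i) T(E₀) ∼ F(i) F(Δ₀) ε(B, A)` followed by
`d(E₁, Δ₁) : F(Δ₁) ε(B, A) ∼ T(E₁)`. -/
def dd (X : Expansion E₀ E₁ i) (D₀ : DiskSection E₀) (D₁ : DiskSection E₁)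
    (hi : ∀ b, i (D₀.sec b) = D₁.sec b) (T : Transfer M) :
    ContinuousMap.HomotopyRel ((X.mapIncl M).comp (T.abs E₀)) (T.abs E₁) {(L.obj P).pt} :=
  ((((T.dPath ⟨P, E₀, D₀⟩).symm).compContinuousMap (X.mapIncl M)).cast rfl
    (X.mapIncl_d D₀ D₁ hi)).trans (T.dPath ⟨P, E₁, D₁⟩)

end Expansion

end

end RefinedTransfer

open RefinedTransfer

namespace RefinedTransfer

/-! ### Calculus of paths of pointed maps -/

/-! Every homotopy needed comes from a family of pointed maps over a contractible space `D`: a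
triangle, a square or a prism `Δ₁ × I`. If two composites of paths are the restrictions of one
family to two paths in `D` with the same endpoints, they are homotopic rel endpoints through pointed
maps, because `D` is simply connected (`IsTraced.pathHomotopic`). Associativity and the unit law for
composites of paths follow in the same way, with `D = I`.

For composable expansions, `c(φ₀₂, λ₀₂)` is the hat homotopy of `λ₀₂` followed by `T(φ₀₂)`. The maps
`(λ₁₂)_u (λ₀₁)_s` with `u ≤ s` form a triangle with long edge `λ₀₂`, so the first factor splits into
`F(i₁₂)` of the homotopy of `λ₀₁`, followed by the homotopy of `λ₁₂` on `F(φ₀₁) T(E₀)`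
(`hatPath_comp`). The value of `T` on the 2-simplex `E₀ → E₁ → E₂` splits the second into `F(φ₁₂)
T(φ₀₁)` followed by `T(φ₁₂)` (`c₂_comp`). The two middle factors of the resulting fourfold composite
are exchanged by a square: the hat homotopy of `λ₁₂` is natural along the path `T(φ₀₁)`
(`hatPath_natural`).

For disk bundles, the prism given by the simplicial homotopy `d` on the 1-simplex `φ : (E₀, Δ₀) →
(E₁, Δ₁)` replaces `T(φ)` by `F(φ) d(E₀, Δ₀)⁻¹` followed by `d(E₁, Δ₁)` (`c₂_homotopic`). Naturality
moves the hat homotopy of `λ` past `d(E₀, Δ₀)⁻¹`, where it acts on `F(Δ₀) ε`. There it is constant,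
because `λ` is constant along the section and the pairing is unital (`hatPath_d`). -/

theorem contractibleSpace_unitInterval : ContractibleSpace I :=
  (convex_Icc (0 : ℝ) 1).contractibleSpace ⟨0, by simp⟩

theorem contractibleSpace_stdSimplex (n : ℕ) :
    ContractibleSpace (stdSimplex ℝ (Fin (n + 1))) :=
  (convex_stdSimplex ℝ (Fin (n + 1))).contractibleSpace
    ⟨_, (stdSimplex.vertex (S := ℝ) (0 : Fin (n + 1))).2⟩

section PathCalculus

variable {X Y : PtdTop} {f g h k : C(X.carrier, Y.carrier)}

theorem PathHomotopic.refl (H : ContinuousMap.HomotopyRel f g {X.pt}) : PathHomotopic H H :=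
  ContinuousMap.HomotopicRel.refl _

theorem PathHomotopic.symm {H H' : ContinuousMap.HomotopyRel f g {X.pt}}
    (e : PathHomotopic H H') : PathHomotopic H' H :=
  ContinuousMap.HomotopicRel.symm e

theorem PathHomotopic.trans {H H' H'' : ContinuousMap.HomotopyRel f g {X.pt}}
    (e : PathHomotopic H H') (e' : PathHomotopic H' H'') : PathHomotopic H H'' :=
  ContinuousMap.HomotopicRel.trans e e'

/-- A homotopy between two paths of pointed maps, as a homotopy in the path parameter. -/
theorem pathHomotopic_iff {H H' : ContinuousMap.HomotopyRel f g {X.pt}} :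
    PathHomotopic H H' ↔
      ∃ K : ContinuousMap.Homotopy (f.comp (ContinuousMap.snd : C(I × X.carrier, X.carrier)))
          (g.comp (ContinuousMap.snd : C(I × X.carrier, X.carrier))),
        (∀ t x, K (t, 0, x) = H (t, x)) ∧ (∀ t x, K (t, 1, x) = H' (t, x)) ∧
        ∀ t s, K (t, s, X.pt) = f X.pt := by
  constructor
  · rintro ⟨K⟩
    -- Exchanging the deformation parameter and the path parameter turns the one kind of homotopy
    -- into the other.
    refine ⟨⟨⟨fun q => K (q.2.1, q.1, q.2.2), by fun_prop⟩, fun q => ?_, fun q => ?_⟩,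
      fun t x => ?_, fun t x => ?_, fun t s => ?_⟩
    · exact (K.eq_fst q.1 (x := (0, q.2)) (Or.inl rfl)).trans (H.apply_zero q.2)
    · exact (K.eq_fst q.1 (x := (1, q.2)) (Or.inr (Or.inl rfl))).trans (H.apply_one q.2)
    · exact K.apply_zero (t, x)
    · exact K.apply_one (t, x)
    · exact (K.eq_fst s (x := (t, X.pt)) (Or.inr (Or.inr rfl))).trans (H.eq_fst t rfl)
  · rintro ⟨K, h0, h1, hp⟩
    refine ⟨⟨⟨⟨fun q => K (q.2.1, q.1, q.2.2), by fun_prop⟩, fun q => h0 q.1 q.2,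
      fun q => h1 q.1 q.2⟩, ?_⟩⟩
    rintro s ⟨t, x⟩ (ht | ht | hx)
    · obtain rfl : t = 0 := ht
      exact (K.apply_zero (s, x)).trans (H.apply_zero x).symm
    · obtain rfl : t = 1 := ht
      exact (K.apply_one (s, x)).trans (H.apply_one x).symm
    · obtain rfl : x = X.pt := hx
      exact (hp t s).trans (H.eq_fst t rfl).symm

/-- With the path parameter as homotopy parameter, the two deformations are themselves homotopies
that can be concatenated, at every value of the deformation parameter at once. -/
theorem PathHomotopic.hcomp {H H' : ContinuousMap.HomotopyRel f g {X.pt}}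
    {K K' : ContinuousMap.HomotopyRel g h {X.pt}} (e : PathHomotopic H H')
    (e' : PathHomotopic K K') : PathHomotopic (H.trans K) (H'.trans K') := by
  obtain ⟨A, hA0, hA1, hAp⟩ := pathHomotopic_iff.1 e
  obtain ⟨B, hB0, hB1, hBp⟩ := pathHomotopic_iff.1 e'
  refine pathHomotopic_iff.2 ⟨A.trans B, fun t x => ?_, fun t x => ?_, fun t s => ?_⟩
  · rw [ContinuousMap.Homotopy.trans_apply, ContinuousMap.HomotopyRel.trans_apply]
    split_ifs
    · exact hA0 _ _
    · exact hB0 _ _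
  · rw [ContinuousMap.Homotopy.trans_apply, ContinuousMap.HomotopyRel.trans_apply]
    split_ifs
    · exact hA1 _ _
    · exact hB1 _ _
  · rw [ContinuousMap.Homotopy.trans_apply]
    split_ifs
    · exact hAp _ _
    -- On the second half the base point stays at `g X.pt`; this is `f X.pt` because `H` is fixed
    -- there.
    · exact (hBp _ _).trans (H.fst_eq_snd rfl).symm

/-- The path of pointed maps `H` is the restriction of the family `G`, parametrized by `D`, along
the path `p` in `D`. -/
def IsTraced {D : Type*} [TopologicalSpace D] (G : C(D × X.carrier, Y.carrier)) {a b : D}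
    (p : Path a b) (H : ContinuousMap.HomotopyRel f g {X.pt}) : Prop :=
  ∀ t x, H (t, x) = G (p t, x)

/-! ### Paths traced in a simply connected parameter space -/

section IsTraced

variable {D : Type*} [TopologicalSpace D] {G : C(D × X.carrier, Y.carrier)} {a b c d : D}

theorem IsTraced.trans {p : Path a b} {q : Path b c} {H : ContinuousMap.HomotopyRel f g {X.pt}}
    {K : ContinuousMap.HomotopyRel g h {X.pt}} (hp : IsTraced G p H) (hq : IsTraced G q K) :
    IsTraced G (p.trans q) (H.trans K) := by
  intro t x
  rw [ContinuousMap.HomotopyRel.trans_apply, Path.trans_apply]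
  split_ifs
  · exact hp _ _
  · exact hq _ _

/-- A homotopy rel endpoints from `p` to `p'` in `D`, composed with the family `G`, is the required
homotopy. It passes through pointed maps because all members of the family are pointed. -/
theorem IsTraced.pathHomotopic [SimplyConnectedSpace D] {p p' : Path a b}
    {H H' : ContinuousMap.HomotopyRel f g {X.pt}}
    (hp : IsTraced G p H) (hp' : IsTraced G p' H') (hG : ∀ s, G (s, X.pt) = Y.pt) :
    PathHomotopic H H' := by
  obtain ⟨e⟩ := SimplyConnectedSpace.paths_homotopic p p'
  have h0 : ∀ x, G (a, x) = f x := fun x => by simpa using (hp 0 x).symm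
  have h1 : ∀ x, G (b, x) = g x := fun x => by simpa using (hp 1 x).symm
  refine pathHomotopic_iff.2 ⟨⟨⟨fun q => G (e (q.2.1, q.1), q.2.2), by fun_prop⟩, fun q => ?_,
    fun q => ?_⟩, fun t x => ?_, fun t x => ?_, fun t s => ?_⟩
  · exact (congrArg (fun z => G (z, q.2)) (e.source q.1)).trans (h0 q.2)
  · exact (congrArg (fun z => G (z, q.2)) (e.target q.1)).trans (h1 q.2)
  · exact (congrArg (fun z => G (z, x)) (e.apply_zero t)).trans (hp t x).symm
  · exact (congrArg (fun z => G (z, x)) (e.apply_one t)).trans (hp' t x).symm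
  · exact (hG _).trans ((hG a).symm.trans (h0 _))

/-- The two halves of a path that traces a composite. -/
theorem IsTraced.exists_of_trans {p : Path a c} {H : ContinuousMap.HomotopyRel f g {X.pt}}
    {K : ContinuousMap.HomotopyRel g h {X.pt}} (hp : IsTraced G p (H.trans K)) :
    ∃ (b : D) (q : Path a b) (r : Path b c), IsTraced G q H ∧ IsTraced G r K := by
  -- `u` and `v` parametrize the two halves of `I`, so the intermediate point is the midpoint of
  -- `p`.
  let u : C(I, I) := ⟨fun t => ⟨(t : ℝ) / 2, by
    constructor <;> linarith [t.2.1, t.2.2]⟩, by fun_prop⟩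
  let v : C(I, I) := ⟨fun t => ⟨((t : ℝ) + 1) / 2, by
    constructor <;> linarith [t.2.1, t.2.2]⟩, by fun_prop⟩
  have hu0 : u 0 = 0 := Subtype.ext (by simp [u])
  have hv1 : v 1 = 1 := Subtype.ext (by simp [v])
  have huv : v 0 = u 1 := Subtype.ext (by simp [u, v])
  refine ⟨p (u 1), ⟨p.toContinuousMap.comp u, ?_, rfl⟩, ⟨p.toContinuousMap.comp v, ?_, ?_⟩,
    fun t x => ?_, fun t x => ?_⟩
  · exact (congrArg p hu0).trans p.source
  · exact congrArg p huv
  · exact (congrArg p hv1).trans p.target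
  · refine Eq.trans ?_ (hp (u t) x)
    have ht : ((u t : I) : ℝ) ≤ 1 / 2 := by
      have := t.2.2
      simp only [u, ContinuousMap.coe_mk]
      linarith
    rw [ContinuousMap.HomotopyRel.trans_apply, dif_pos ht]
    refine congrArg (fun s => H (s, x)) (Subtype.ext ?_)
    simp only [u, ContinuousMap.coe_mk]
    ring
  · refine Eq.trans ?_ (hp (v t) x)
    rw [ContinuousMap.HomotopyRel.trans_apply]
    split_ifs with ht
    · have ht0 : t = 0 := by
        refine Subtype.ext (le_antisymm ?_ t.2.1)
        simp only [v, ContinuousMap.coe_mk] at ht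
        change (t : ℝ) ≤ 0
        linarith
      subst ht0
      refine (K.apply_zero x).trans ((H.apply_one x).symm.trans ?_)
      refine congrArg (fun s => H (s, x)) (Subtype.ext ?_)
      simp [v]
    · refine congrArg (fun s => K (s, x)) (Subtype.ext ?_)
      simp only [v, ContinuousMap.coe_mk]
      ring

end IsTraced

/-- The path from `0` to `1` in `I`. -/
def unitPath : Path (0 : I) 1 where
  toFun t := t
  source' := rfl
  target' := rfl

/-! ### Associativity, unit law and interchange -/

theorem isTraced_unitPath (H : ContinuousMap.HomotopyRel f g {X.pt}) :
    IsTraced H.toContinuousMap unitPath H :=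
  fun _ _ => rfl

/-- No reparametrization has to be written down. One bracketing is a family over `I`, traced by the
unit path; cutting this path yields paths in `I` that trace the three factors, and joining them in
the other bracketing gives a second path from `0` to `1`. -/
theorem pathHomotopic_assoc (hf : f X.pt = Y.pt) (H : ContinuousMap.HomotopyRel f g {X.pt})
    (K : ContinuousMap.HomotopyRel g h {X.pt}) (J : ContinuousMap.HomotopyRel h k {X.pt}) :
    PathHomotopic ((H.trans K).trans J) (H.trans (K.trans J)) := by
  have := contractibleSpace_unitInterval
  have h0 := isTraced_unitPath (H.trans (K.trans J))
  obtain ⟨_, p, _, hp, h1⟩ := h0.exists_of_trans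
  obtain ⟨_, q, r, hq, hr⟩ := h1.exists_of_trans
  exact ((hp.trans hq).trans hr).pathHomotopic h0 fun s =>
    ((H.trans (K.trans J)).eq_fst s rfl).trans hf

theorem pathHomotopic_trans_refl (hf : f X.pt = Y.pt)
    (H : ContinuousMap.HomotopyRel f g {X.pt}) :
    PathHomotopic (H.trans (ContinuousMap.HomotopyRel.refl g {X.pt})) H := by
  have := contractibleSpace_unitInterval
  -- The constant path at `g` is traced by standing still at the endpoint of the family `H`.
  have hr : IsTraced H.toContinuousMap (Path.refl (1 : I))
      (ContinuousMap.HomotopyRel.refl g {X.pt}) := fun _ x => (H.apply_one x).symm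
  exact ((isTraced_unitPath H).trans hr).pathHomotopic (isTraced_unitPath H) fun s =>
    (H.eq_fst s rfl).trans hf

/-- Replacing the two middle factors of a fourfold composite. -/
theorem pathHomotopic_interchange {g₁ g₂ g₂' g₃ : C(X.carrier, Y.carrier)} (hf : f X.pt = Y.pt)
    (A : ContinuousMap.HomotopyRel f g₁ {X.pt}) {B : ContinuousMap.HomotopyRel g₁ g₂ {X.pt}}
    {C : ContinuousMap.HomotopyRel g₂ g₃ {X.pt}} {B' : ContinuousMap.HomotopyRel g₁ g₂' {X.pt}}
    {C' : ContinuousMap.HomotopyRel g₂' g₃ {X.pt}} (D : ContinuousMap.HomotopyRel g₃ k {X.pt})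
    (e : PathHomotopic (B.trans C) (B'.trans C')) :
    PathHomotopic ((A.trans B).trans (C.trans D)) ((A.trans B').trans (C'.trans D)) := by
  have h₁ : g₁ X.pt = Y.pt := (A.fst_eq_snd rfl).symm.trans hf
  -- Rebracketing brings the two middle factors together. It is used once for `B`, `C` and once,
  -- backwards, for `B'`, `C'`.
  have key : ∀ {g : C(X.carrier, Y.carrier)} (P : ContinuousMap.HomotopyRel g₁ g {X.pt})
      (Q : ContinuousMap.HomotopyRel g g₃ {X.pt}),
      PathHomotopic ((A.trans P).trans (Q.trans D)) (A.trans ((P.trans Q).trans D)) :=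
    fun P Q => (pathHomotopic_assoc hf _ _ _).trans
      ((PathHomotopic.refl A).hcomp (pathHomotopic_assoc h₁ P Q D).symm)
  exact (key B C).trans (((PathHomotopic.refl A).hcomp (e.hcomp (.refl D))).trans (key B' C').symm)

end PathCalculus
/-! ### Edges of simplices -/

/-- The order preserving map `{0, 1} → {0, …, n}` with values `i ≤ j`. -/
def edgeHom {n : ℕ} {i j : Fin (n + 1)} (h : i ≤ j) : Fin 2 →o Fin (n + 1) where
  toFun := ![i, j]
  monotone' := by
    intro a b hab
    fin_cases a <;> fin_cases b
    · exact le_rfl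
    · exact h
    · exact absurd hab (by decide)
    · exact le_rfl

/-- The edge from the vertex `i` to the vertex `j` of the standard simplex. -/
noncomputable def edgePath {n : ℕ} {i j : Fin (n + 1)} (h : i ≤ j) :
    Path (stdSimplex.vertex (S := ℝ) i) (stdSimplex.vertex j) where
  toFun t := stdSimplex.map (edgeHom h) (stdSimplexHomeomorphUnitInterval.symm t)
  continuous_toFun := (stdSimplex.continuous_map _).comp
    stdSimplexHomeomorphUnitInterval.symm.continuous
  source' := by
    have : stdSimplexHomeomorphUnitInterval.symm 0 = stdSimplex.vertex (S := ℝ) (0 : Fin 2) := by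
      rw [Homeomorph.symm_apply_eq]; exact stdSimplexHomeomorphUnitInterval_zero.symm
    rw [this, stdSimplex.map_vertex]; rfl
  target' := by
    have : stdSimplexHomeomorphUnitInterval.symm 1 = stdSimplex.vertex (S := ℝ) (1 : Fin 2) := by
      rw [Homeomorph.symm_apply_eq]; exact stdSimplexHomeomorphUnitInterval_one.symm
    rw [this, stdSimplex.map_vertex]; rfl

/-- The affine map of a standard simplex to `I` with value `0` or `1` at each vertex. -/
noncomputable def simplexToI {n : ℕ} (v : Fin (n + 1) → Fin 2) : C(stdSimplex ℝ (Fin (n + 1)), I) :=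
  ⟨fun p => stdSimplexHomeomorphUnitInterval (stdSimplex.map v p),
    stdSimplexHomeomorphUnitInterval.continuous.comp (stdSimplex.continuous_map v)⟩

theorem simplexToI_edgePath {n : ℕ} (v : Fin (n + 1) → Fin 2) {i j : Fin (n + 1)} (h : i ≤ j)
    (h0 : v i = 0) (h1 : v j = 1) (t : I) : simplexToI v (edgePath h t) = t := by
  change stdSimplexHomeomorphUnitInterval (stdSimplex.map v (stdSimplex.map (edgeHom h) _)) = t
  -- On vertices the composite is the identity of `{0, 1}`, so on `Δ₁` it is the identity.
  have e : v ∘ edgeHom h = id := by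
    funext a
    fin_cases a
    · exact h0
    · exact h1
  rw [stdSimplex.map_comp_apply, e, stdSimplex.map_id_apply, Homeomorph.apply_symm_apply]

theorem simplexToI_edgePath_of_eq {n : ℕ} (v : Fin (n + 1) → Fin 2) {i j : Fin (n + 1)}
    (h : i ≤ j) (hv : v i = v j) (t : I) :
    simplexToI v (edgePath h t) = stdSimplexHomeomorphUnitInterval (stdSimplex.vertex (v i)) := by
  change stdSimplexHomeomorphUnitInterval (stdSimplex.map v (stdSimplex.map (edgeHom h) _)) = _
  -- A constant vertex map factors through the one-point simplex `Δ₀`, so the affine map takes only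
  -- the value at that vertex.
  have e : v ∘ edgeHom h = (fun _ : Fin 1 => v i) ∘ (fun _ : Fin 2 => (0 : Fin 1)) := by
    funext a
    fin_cases a
    · rfl
    · exact hv.symm
  rw [stdSimplex.map_comp_apply, e, ← stdSimplex.map_comp_apply,
    Subsingleton.elim (stdSimplex.map (fun _ : Fin 2 => (0 : Fin 1)) _) (stdSimplex.vertex 0),
    stdSimplex.map_vertex]

theorem simplexToI_edgePath_zero {n : ℕ} (v : Fin (n + 1) → Fin 2) {i j : Fin (n + 1)}
    (h : i ≤ j) (h0 : v i = 0) (h1 : v j = 0) (t : I) : simplexToI v (edgePath h t) = 0 := by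
  rw [simplexToI_edgePath_of_eq v h (h0.trans h1.symm), h0]
  exact stdSimplexHomeomorphUnitInterval_zero

theorem simplexToI_edgePath_one {n : ℕ} (v : Fin (n + 1) → Fin 2) {i j : Fin (n + 1)}
    (h : i ≤ j) (h0 : v i = 1) (h1 : v j = 1) (t : I) : simplexToI v (edgePath h t) = 1 := by
  rw [simplexToI_edgePath_of_eq v h (h0.trans h1.symm), h0]
  exact stdSimplexHomeomorphUnitInterval_one

/-! ### Homotopies parametrized by a simplex -/

/-- Needed for `Δ_n` to be the second factor of a product of pairs. -/
instance compactlyGeneratedSpace_stdSimplex (n : ℕ) :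
    CompactlyGeneratedSpace (stdSimplex ℝ (Fin (n + 1))) :=
  haveI : T2Space (stdSimplex ℝ (Fin (n + 1))) := inferInstance
  haveI : CompactSpace (stdSimplex ℝ (Fin (n + 1))) := inferInstance
  inferInstance

namespace MultFunctor

variable (M : MultFunctor)

/-- The map `Δ_n → |Δ_n| → L(Δ_n)` given by the identity as a singular simplex. -/
noncomputable def simplexIota (n : ℕ) :
    C(stdSimplex ℝ (Fin (n + 1)), (L.obj (CGPair.ofSpace (stdSimplex ℝ (Fin (n + 1))))).carrier) :=
  ⟨fun p => LMk (CGPair.ofSpace (stdSimplex ℝ (Fin (n + 1)))) (charMap (ContinuousMap.id _) p),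
    continuous_quot_mk.comp (continuous_inl.comp (charMap _).continuous)⟩

/-- For `h : X × Δ_n → Y`, the family of maps `F(X) ∧ Δ_n⁺ → F(X) ∧ L(Δ_n) → F(X × Δ_n) → F(Y)`. -/
noncomputable def simplexHat {n : ℕ} {X Y : CGPair}
    (h : X.prod (CGPair.ofSpace (stdSimplex ℝ (Fin (n + 1)))) ⟶ Y) :
    C((M.F.obj X).carrier × stdSimplex ℝ (Fin (n + 1)), (M.F.obj Y).carrier) :=
  ⟨fun q => (M.F.map h).toMap (M.omega X _ q.1 (simplexIota n q.2)),
    (M.F.map h).toMap.continuous.comp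
      (M.omega_continuous X _ (CompHaus.of (stdSimplex ℝ (Fin (n + 1)))) (simplexIota n))⟩

theorem simplexHat_pt {n : ℕ} {X Y : CGPair}
    (h : X.prod (CGPair.ofSpace (stdSimplex ℝ (Fin (n + 1)))) ⟶ Y)
    (p : stdSimplex ℝ (Fin (n + 1))) : M.simplexHat h ((M.F.obj X).pt, p) = (M.F.obj Y).pt :=
  (congrArg (M.F.map h).toMap (M.omega_pt_left X _ _)).trans (M.F.map h).map_pt

/-- Naturality of the pairing in the form used below: an identity between homotopies of spaces,
checked pointwise, passes to the induced homotopies. Precomposition, restriction to an edge and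
constancy are the cases of interest. -/
theorem map_omega {X X' Y Y' Z : CGPair} (f : X ⟶ X') (g : Y ⟶ Y') (h' : X'.prod Y' ⟶ Z)
    (h : X.prod Y ⟶ Z) (e : ∀ x y, h'.toMap (KProd.mk (f.toMap x) (g.toMap y)) =
      h.toMap (KProd.mk x y)) (x : (M.F.obj X).carrier) (l : (L.obj Y).carrier) :
    (M.F.map h').toMap (M.omega X' Y' ((M.F.map f).toMap x) ((L.map g).toMap l)) =
      (M.F.map h).toMap (M.omega X Y x l) := by
  have e' : CGPair.prodMap f g ≫ h' = h :=
    CGPair.Hom.ext (ContinuousMap.ext fun q => e q.1 q.2)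
  rw [M.omega_natural, ← e', M.F.map_comp]
  rfl

theorem map_id_apply {X : CGPair} (x : (M.F.obj X).carrier) : (M.F.map (𝟙 X)).toMap x = x := by
  rw [M.F.map_id]; rfl

theorem hat_map {X X' Y : CGPair} (f : X ⟶ X') (h' : X'.prod Ipair ⟶ Y) (h : X.prod Ipair ⟶ Y)
    (e : ∀ x t, h'.toMap (KProd.mk (f.toMap x) t) = h.toMap (KProd.mk x t))
    (x : (M.F.obj X).carrier) (t : I) :
    M.hat h' ((M.F.map f).toMap x, t) = M.hat h (x, t) := by
  have key := M.map_omega f (𝟙 Ipair) h' h e x (iota t)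
  rw [L.map_id] at key
  exact key

theorem map_hat {X Y Y' : CGPair} (h : X.prod Ipair ⟶ Y) (f : Y ⟶ Y')
    (x : (M.F.obj X).carrier) (t : I) :
    (M.F.map f).toMap (M.hat h (x, t)) = M.hat (h ≫ f) (x, t) := by
  simp only [hat, M.F.map_comp]
  rfl

/-- In the realization, the edge of the singular simplex `id` is identified with the singular
1-simplex `Δ₁ → Δ_n` that it spans. The same 1-simplex is the image of `Δ₁ ≅ I` under the edge path,
since the homeomorphism with `I` cancels. The restriction to an edge is therefore strict, with no
correcting homotopy. -/
theorem simplexIota_edgePath {n : ℕ} {i j : Fin (n + 1)} (hij : i ≤ j) (t : I) :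
    simplexIota n (edgePath hij t) =
      (L.map (⟨(edgePath hij).toContinuousMap, fun _ h => h⟩ :
        Ipair ⟶ CGPair.ofSpace (stdSimplex ℝ (Fin (n + 1))))).toMap (iota t) := by
  refine congrArg (LMk _) ((charMap_comp _ (edgeHom hij) _).trans ?_)
  refine Eq.trans ?_ (charMap_map _ _ _).symm
  congr 1
  congr 1
  refine ContinuousMap.ext fun p => ?_
  change stdSimplex.map (edgeHom hij) p = stdSimplex.map (edgeHom hij)
    (stdSimplexHomeomorphUnitInterval.symm (stdSimplexHomeomorphUnitInterval p))
  rw [Homeomorph.symm_apply_apply]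

/-- The restriction of a family parametrized by a simplex to an edge. -/
theorem simplexHat_edgePath {n : ℕ} {X Y : CGPair} {i j : Fin (n + 1)} (hij : i ≤ j)
    (h : X.prod (CGPair.ofSpace (stdSimplex ℝ (Fin (n + 1)))) ⟶ Y) (k : X.prod Ipair ⟶ Y)
    (e : ∀ x t, h.toMap (KProd.mk x (edgePath hij t)) = k.toMap (KProd.mk x t))
    (x : (M.F.obj X).carrier) (t : I) :
    M.simplexHat h (x, edgePath hij t) = M.hat k (x, t) := by
  have key := M.map_omega (𝟙 X) (⟨(edgePath hij).toContinuousMap, fun _ h => h⟩ :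
        Ipair ⟶ CGPair.ofSpace (stdSimplex ℝ (Fin (n + 1)))) h k e x (iota t)
  rw [M.map_id_apply, ← simplexIota_edgePath] at key
  exact key

/-- A homotopy that is constant induces the constant homotopy. -/
theorem hat_const {X Y : CGPair} (h : X.prod Ipair ⟶ Y) (f : X ⟶ Y)
    (e : ∀ x t, h.toMap (KProd.mk x t) = f.toMap x) (x : (M.F.obj X).carrier) (t : I) :
    M.hat h (x, t) = (M.F.map f).toMap x := by
  -- A constant homotopy factors through the projection of `I` to a point, where the unit axiom
  -- `omega_point` applies.
  have key := M.map_omega (𝟙 X) (⟨ContinuousMap.const _ PUnit.unit, fun _ h => h⟩ :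
    Ipair ⟶ CGPair.ofSpace PUnit) (X.prodPoint ≫ f) h (fun x t => (e x t).symm) x (iota t)
  rw [M.map_id_apply, M.F.map_comp] at key
  exact key.symm.trans (congrArg (M.F.map f).toMap (M.omega_point X x _))

end MultFunctor

/-! ### Edges in simplicial transformations -/

namespace SimplicialTransformation

variable {𝒞 : Type 1} [Category.{0} 𝒞] {S : ∀ {p : ℕ}, ComposableArrows 𝒞 p → Prop}
  {F G : 𝒞 ⥤ PtdTop} {K : Type} [TopologicalSpace K]

theorem app_one_simplex (T : SimplicialTransformation S F G K) (D : ComposableArrows 𝒞 1)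
    (hD : S D) (hf : S (ComposableArrows.mk₁ (D.map' 0 1)))
    (x : (F.obj (D.obj 0)).carrier) (k : K) (t : stdSimplex ℝ (Fin 2)) :
    T.app D hD (x, k, t) = T.app (ComposableArrows.mk₁ (D.map' 0 1)) hf (x, k, t) := by
  obtain ⟨X, Y, f, rfl⟩ := ComposableArrows.mk₁_surjective D
  rfl

/-- This is simplicial compatibility for the operator `edgeHom`. The outer maps appear because the
family over the whole simplex starts at `F(C₀)` and ends in `G(C_p)`, whereas the edge only runs
from `C_i` to `C_j`. -/
theorem app_edgePath (T : SimplicialTransformation S F G K) {p : ℕ} (C : ComposableArrows 𝒞 p)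
    (hC : S C) {i j : Fin (p + 1)} (hij : i ≤ j)
    (hf : S (ComposableArrows.mk₁ (C.map (homOfLE hij))))
    (x : (F.obj (C.obj 0)).carrier) (k : K) (t : I) :
    T.app C hC (x, k, edgePath hij t) =
      (G.map (C.map (homOfLE (Fin.le_last j)))).toMap
        (T.app (ComposableArrows.mk₁ (C.map (homOfLE hij))) hf
          ((F.map (C.map (homOfLE (Fin.zero_le i)))).toMap x, k,
            stdSimplexHomeomorphUnitInterval.symm t)) := by
  have e : C.whiskerLeft (edgeHom hij).monotone.functor =
      ComposableArrows.mk₁ (C.map (homOfLE hij)) :=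
    ComposableArrows.ext₁ rfl rfl
      ((Category.id_comp _).trans (Category.comp_id _)).symm
  have hD : S (C.whiskerLeft (edgeHom hij).monotone.functor) := e ▸ hf
  refine (T.app_map (edgeHom hij) C hC hD x k _).trans ?_
  exact congrArg (G.map (C.map (homOfLE (Fin.le_last j)))).toMap
    (T.app_one_simplex _ hD hf _ k _)

end SimplicialTransformation
/-! ### The homotopies of an expansion -/

theorem L_map_eq_self {P : CGPair} (f : P ⟶ P) (hf : f = 𝟙 P) (x : (L.obj P).carrier) :
    (L.map f).toMap x = x := by
  rw [hf, L.map_id]; rfl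

/-- Fiberwise diffeomorphisms of absolute bundles are excisions and are closed under composition,
which also covers the long edge. -/
theorem excisiveSimplex_absMap₂ {P : CGPair} {E E' E'' : SmoothBundle P.carrier}
    {g : E.total → E'.total} {g' : E'.total → E''.total}
    (h : IsFiberwiseDiffeo E E' (𝟙 P : P ⟶ P).toMap g)
    (h' : IsFiberwiseDiffeo E' E'' (𝟙 P : P ⟶ P).toMap g') :
    ExcisiveSimplex (ComposableArrows.mk₂ (BundlePair.absMap (𝟙 P) g h.smooth)
      (BundlePair.absMap (𝟙 P) g' h'.smooth)) := by
  intro j k hjk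
  fin_cases j <;> fin_cases k
  · exact (IsFiberwiseDiffeo.id E).isExcision (f := 𝟙 P)
  · exact h.isExcision
  · exact (h'.comp h (𝟙 P : P ⟶ P).toMap.continuous).isExcision (f := 𝟙 P)
  · exact absurd hjk (by decide)
  · exact (IsFiberwiseDiffeo.id E').isExcision (f := 𝟙 P)
  · exact h'.isExcision
  · exact absurd hjk (by decide)
  · exact absurd hjk (by decide)
  · exact (IsFiberwiseDiffeo.id E'').isExcision (f := 𝟙 P)

/-- Composites such as `F(φ₁₂) F(φ₀₁)` and `F(φ₀₂)` agree only up to a proved equality, so paths are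
cast along it. Casts at an intermediate map cancel. -/
theorem homotopyRel_cast_trans_cast {X Y : Type*} [TopologicalSpace X] [TopologicalSpace Y]
    {S : Set X} {f f' g g' h h' : C(X, Y)} (H : ContinuousMap.HomotopyRel f g S)
    (K : ContinuousMap.HomotopyRel g h S) (a : f = f') (e : g = g') (b : h = h') :
    (H.cast a e).trans (K.cast e b) = (H.trans K).cast a b := by
  subst a e b; rfl

namespace Expansion

variable {P : CGPair} {E₀ E₁ E₂ : SmoothBundle P.carrier} {i : E₀.total → E₁.total}
  {i' : E₁.total → E₂.total} {M : MultFunctor}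

theorem mapPhi_comp (X : Expansion E₀ E₁ i) (X' : Expansion E₁ E₂ i')
    (h : IsLT E₀ E₂ (i' ∘ i)) {Z : PtdTop}
    (f : C(Z.carrier, (M.F.obj (totalPair P E₀)).carrier)) :
    (X'.mapPhi M).comp ((X.mapPhi M).comp f) = ((X.comp X' h).mapPhi M).comp f :=
  ContinuousMap.ext fun _ => M.map_map _ _ _

/-- The path `F̂(λ)(f ∧ 1) : F(i) f ∼ F(φ) f` for a pointed map `f` to `F(E₀, E₀↓A)`. -/
noncomputable def hatPath (X : Expansion E₀ E₁ i) {Z : PtdTop}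
    (f : C(Z.carrier, (M.F.obj (totalPair P E₀)).carrier))
    (hf : f Z.pt = (M.F.obj (totalPair P E₀)).pt) :
    ContinuousMap.HomotopyRel ((X.mapIncl M).comp f) ((X.mapPhi M).comp f) {Z.pt} where
  toFun q := M.hat X.lamMap (f q.2, q.1)
  continuous_toFun := by fun_prop
  map_zero_left x := M.hat_zero X.lamMap (totalMap E₀ E₁ (𝟙 P) i X.lt.isEmbedding.continuous
    X.lt.proj_eq) X.lam_zero _
  map_one_left x := M.hat_one X.lamMap (totalMap E₀ E₁ (𝟙 P) X.φ X.diffeo.smooth.continuous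
    X.diffeo.smooth.proj_eq) X.lam_one _
  prop' t x hx := by
    obtain rfl : x = Z.pt := hx
    refine ((congrArg (fun y => M.hat X.lamMap (y, t)) hf).trans (M.hat_pt X.lamMap t)).trans ?_
    refine Eq.symm ((congrArg (X.mapIncl M) hf).trans ?_)
    exact (M.F.map _).map_pt

/-- The path `F̂(λ)(f ∧ 1)` is natural in `f` with respect to homotopies of pointed maps. -/
theorem hatPath_natural (X : Expansion E₀ E₁ i) {Z : PtdTop}
    {f f' : C(Z.carrier, (M.F.obj (totalPair P E₀)).carrier)}
    (hf : f Z.pt = (M.F.obj (totalPair P E₀)).pt)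
    (hf' : f' Z.pt = (M.F.obj (totalPair P E₀)).pt)
    (H : ContinuousMap.HomotopyRel f f' {Z.pt}) :
    PathHomotopic (X := Z) (Y := M.F.obj (totalPair P E₁))
      ((H.compContinuousMap (X.mapIncl M)).trans (X.hatPath f' hf'))
      ((X.hatPath f hf).trans (H.compContinuousMap (X.mapPhi M))) := by
  have := contractibleSpace_unitInterval
  -- The square runs along `H` in the first coordinate and along `λ` in the second. The two
  -- composites go round its boundary from `(0, 0)` to `(1, 1)` in the two possible ways.
  let G : C((I × I) × Z.carrier, (M.F.obj (totalPair P E₁)).carrier) :=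
    ⟨fun q => M.hat X.lamMap (H (q.1.1, q.2), q.1.2), by fun_prop⟩
  have h₁ : IsTraced (X := Z) (Y := M.F.obj (totalPair P E₁)) G
      (unitPath.prod (Path.refl (0 : I))) (H.compContinuousMap (X.mapIncl M)) := fun t x =>
    (M.hat_zero X.lamMap (totalMap E₀ E₁ (𝟙 P) i X.lt.isEmbedding.continuous
      X.lt.proj_eq) X.lam_zero (H (t, x))).symm
  have h₂ : IsTraced (X := Z) (Y := M.F.obj (totalPair P E₁)) G
      ((Path.refl (1 : I)).prod unitPath) (X.hatPath f' hf') := fun t x =>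
    congrArg (fun y => M.hat X.lamMap (y, t)) (H.apply_one x).symm
  have h₃ : IsTraced (X := Z) (Y := M.F.obj (totalPair P E₁)) G
      ((Path.refl (0 : I)).prod unitPath) (X.hatPath f hf) := fun t x =>
    congrArg (fun y => M.hat X.lamMap (y, t)) (H.apply_zero x).symm
  have h₄ : IsTraced (X := Z) (Y := M.F.obj (totalPair P E₁)) G
      (unitPath.prod (Path.refl (1 : I))) (H.compContinuousMap (X.mapPhi M)) := fun t x =>
    (M.hat_one X.lamMap (totalMap E₀ E₁ (𝟙 P) X.φ X.diffeo.smooth.continuous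
      X.diffeo.smooth.proj_eq) X.lam_one (H (t, x))).symm
  exact (h₁.trans h₂).pathHomotopic (h₃.trans h₄) fun s =>
    (congrArg (fun y => M.hat X.lamMap (y, s.2)) ((H.eq_fst s.1 rfl).trans hf)).trans
      (M.hat_pt X.lamMap s.2)

/-- The family of maps `(x, p) ↦ λ'(λ(x, s p), u p)`, `p ∈ Δ₂`, with `(s, u)` equal to `(0, 0)`,
`(1, 0)`, `(1, 1)` at the vertices. -/
noncomputable def lamSimplex (X : Expansion E₀ E₁ i) (X' : Expansion E₁ E₂ i') :
    (totalPair P E₀).prod (CGPair.ofSpace (stdSimplex ℝ (Fin (2 + 1)))) ⟶ totalPair P E₂ where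
  toMap := ⟨fun q => X'.lam (X.lam (q.1, simplexToI ![0, 1, 1] q.2), simplexToI ![0, 0, 1] q.2),
    KProd.continuous_of_prod (fun q : E₀.total × stdSimplex ℝ (Fin (2 + 1)) =>
      X'.lam (X.lam (q.1, simplexToI ![0, 1, 1] q.2), simplexToI ![0, 0, 1] q.2)) (by fun_prop)⟩
  mapsTo := by
    rintro q (h | h)
    · exact h.elim
    · exact (congrArg (· ∈ P.sub) ((X'.proj_lam _ _).trans (X.proj_lam q.1 _))).mpr h

/-- The three edges of the triangle `lamSimplex` trace the three paths, and its long edge is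
homotopic to the other two in succession. -/
theorem hatPath_comp (X : Expansion E₀ E₁ i) (X' : Expansion E₁ E₂ i')
    (h : IsLT E₀ E₂ (i' ∘ i)) {Z : PtdTop}
    (f : C(Z.carrier, (M.F.obj (totalPair P E₀)).carrier))
    (hf : f Z.pt = (M.F.obj (totalPair P E₀)).pt)
    (hf' : (X.mapPhi M).comp f Z.pt = (M.F.obj (totalPair P E₁)).pt)
    (e₁ : (X'.mapIncl M).comp ((X.mapIncl M).comp f) = ((X.comp X' h).mapIncl M).comp f) :
    PathHomotopic (X := Z) (Y := M.F.obj (totalPair P E₂)) ((X.comp X' h).hatPath f hf)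
      ((((X.hatPath f hf).compContinuousMap (X'.mapIncl M)).cast e₁ rfl).trans
        ((X'.hatPath ((X.mapPhi M).comp f) hf').cast rfl (mapPhi_comp X X' h f))) := by
  have := contractibleSpace_stdSimplex 2
  let G : C(stdSimplex ℝ (Fin (2 + 1)) × Z.carrier, (M.F.obj (totalPair P E₂)).carrier) :=
    ⟨fun q => M.simplexHat (lamSimplex X X') (f q.2, q.1), by fun_prop⟩
  have h₁ : IsTraced (X := Z) (Y := M.F.obj (totalPair P E₂)) G
      (edgePath (show (0 : Fin 3) ≤ 2 by decide)) ((X.comp X' h).hatPath f hf) := fun t x => by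
    refine (M.simplexHat_edgePath (show (0 : Fin 3) ≤ 2 by decide) (lamSimplex X X')
      (X.comp X' h).lamMap (fun y t => ?_) (f x) t).symm
    change X'.lam (X.lam (y, simplexToI _ _), simplexToI _ _) = X'.lam (X.lam (y, t), t)
    -- On the long edge `s = u = t`, which is the formula for the composite `λ₀₂`.
    erw [simplexToI_edgePath _ _ rfl rfl, simplexToI_edgePath _ _ rfl rfl]
  have h₂ : IsTraced (X := Z) (Y := M.F.obj (totalPair P E₂)) G
      (edgePath (show (0 : Fin 3) ≤ 1 by decide))
      (((X.hatPath f hf).compContinuousMap (X'.mapIncl M)).cast e₁ rfl) := fun t x => by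
    refine (M.map_hat X.lamMap _ (f x) t).trans ?_
    refine (M.simplexHat_edgePath (show (0 : Fin 3) ≤ 1 by decide) (lamSimplex X X')
      _ (fun y t => ?_) (f x) t).symm
    change X'.lam (X.lam (y, simplexToI _ _), simplexToI _ _) = i' (X.lam (y, t))
    -- Here `u = 0`, so `λ₁₂` contributes the inclusion.
    erw [simplexToI_edgePath _ _ rfl rfl, simplexToI_edgePath_zero _ _ rfl rfl]
    exact X'.lam_zero _
  have h₃ : IsTraced (X := Z) (Y := M.F.obj (totalPair P E₂)) G
      (edgePath (show (1 : Fin 3) ≤ 2 by decide))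
      ((X'.hatPath ((X.mapPhi M).comp f) hf').cast rfl (mapPhi_comp X X' h f)) := fun t x => by
    refine (M.hat_map (totalMap E₀ E₁ (𝟙 P) X.φ X.diffeo.smooth.continuous
      X.diffeo.smooth.proj_eq) X'.lamMap (CGPair.prodMap (totalMap E₀ E₁ (𝟙 P) X.φ
        X.diffeo.smooth.continuous X.diffeo.smooth.proj_eq) (𝟙 Ipair) ≫ X'.lamMap)
      (fun _ _ => rfl) (f x) t).trans ?_
    refine (M.simplexHat_edgePath (show (1 : Fin 3) ≤ 2 by decide) (lamSimplex X X')
      _ (fun y t => ?_) (f x) t).symm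
    change X'.lam (X.lam (y, simplexToI _ _), simplexToI _ _) = X'.lam (X.φ y, t)
    -- Here `s = 1`, so `λ₀₁` contributes `φ₀₁`.
    erw [simplexToI_edgePath_one _ _ rfl rfl, simplexToI_edgePath _ _ rfl rfl]
    exact congrArg (fun z => X'.lam (z, t)) (X.lam_one y)
  exact h₁.pathHomotopic (h₂.trans h₃) fun s =>
    (congrArg (fun y => M.simplexHat (lamSimplex X X') (y, s)) hf).trans
      (M.simplexHat_pt (lamSimplex X X') s)

/-- The value of `T` on the 2-simplex `E₀ → E₁ → E₂` is a family over `Δ₂` with long edge `T(φ₁₂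
φ₀₁)`. All its values lie in `F(E₂)`, so the edge `E₀ → E₁` appears after composition with `F(φ₁₂)`.
-/
theorem c₂_comp (X : Expansion E₀ E₁ i) (X' : Expansion E₁ E₂ i')
    (h : IsLT E₀ E₂ (i' ∘ i)) (T : Transfer M) :
    PathHomotopic ((X.comp X' h).c₂ T)
      ((((X.c₂ T).compContinuousMap (X'.mapPhi M)).cast
        (mapPhi_comp X X' h (Z := L.obj P) (T.abs E₀)) rfl).trans (X'.c₂ T)) := by
  have := contractibleSpace_stdSimplex 2
  have hC := excisiveSimplex_absMap₂ X.diffeo X'.diffeo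
  set C := ComposableArrows.mk₂ (BundlePair.absMap (𝟙 P) X.φ X.diffeo.smooth)
    (BundlePair.absMap (𝟙 P) X'.φ X'.diffeo.smooth)
  let G : C(stdSimplex ℝ (Fin (2 + 1)) × (L.obj P).carrier,
      (M.F.obj (totalPair P E₂)).carrier) :=
    ⟨fun q => T.T.app C hC (q.2, PUnit.unit, q.1),
      (T.T.app C hC).continuous.comp
        (continuous_snd.prodMk (continuous_const.prodMk continuous_fst))⟩
  have h₁ : IsTraced (X := L.obj P) (Y := M.F.obj (totalPair P E₂)) G
      (edgePath (show (0 : Fin 3) ≤ 2 by decide)) ((X.comp X' h).c₂ T) := fun t x => by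
    refine ((T.T.app_edgePath C hC (show (0 : Fin 3) ≤ 2 by decide)
      (excisiveSimplex_absMap (X.comp X' h).diffeo) x PUnit.unit t).trans ?_).symm
    refine (M.map_id_apply _).trans ?_
    exact congrArg (fun y => (X.comp X' h).c₂ T (t, y)) (L_map_eq_self (𝟙 P) rfl x)
  have h₂ : IsTraced (X := L.obj P) (Y := M.F.obj (totalPair P E₂)) G
      (edgePath (show (0 : Fin 3) ≤ 1 by decide))
      (((X.c₂ T).compContinuousMap (X'.mapPhi M)).cast
        (mapPhi_comp X X' h (Z := L.obj P) (T.abs E₀)) rfl) := fun t x => by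
    refine ((T.T.app_edgePath C hC (show (0 : Fin 3) ≤ 1 by decide)
      (excisiveSimplex_absMap X.diffeo) x PUnit.unit t).trans ?_).symm
    exact congrArg (fun y => X'.mapPhi M (X.c₂ T (t, y))) (L_map_eq_self (𝟙 P) rfl x)
  have h₃ : IsTraced (X := L.obj P) (Y := M.F.obj (totalPair P E₂)) G
      (edgePath (show (1 : Fin 3) ≤ 2 by decide)) (X'.c₂ T) := fun t x => by
    refine ((T.T.app_edgePath C hC (show (1 : Fin 3) ≤ 2 by decide)
      (excisiveSimplex_absMap X'.diffeo) x PUnit.unit t).trans ?_).symm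
    refine (M.map_id_apply _).trans ?_
    exact congrArg (fun y => X'.c₂ T (t, y)) (L_map_eq_self (𝟙 P) rfl x)
  exact h₁.pathHomotopic (h₂.trans h₃) fun s => T.T.app_pt C hC PUnit.unit s

/-! ### Assembling the homotopy for composable expansions -/

theorem mapPhi_abs_pt (X : Expansion E₀ E₁ i) (T : Transfer M) :
    (X.mapPhi M).comp (T.abs E₀) (L.obj P).pt = (M.F.obj (totalPair P E₁)).pt :=
  (congrArg (X.mapPhi M) (T.abs_pt E₀)).trans (M.F.map _).map_pt

theorem mapIncl_abs_pt (X : Expansion E₀ E₁ i) (T : Transfer M) :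
    (X.mapIncl M).comp (T.abs E₀) (L.obj P).pt = (M.F.obj (totalPair P E₁)).pt :=
  (congrArg (X.mapIncl M) (T.abs_pt E₀)).trans X.mapIncl_image_pt

/-- Composition with `F(i₁₂)` distributes over concatenation, so the path is literally a fourfold
composite and `pathHomotopic_interchange` applies to it. -/
theorem cc_eq_trans (X : Expansion E₀ E₁ i) (X' : Expansion E₁ E₂ i')
    (h : IsLT E₀ E₂ (i' ∘ i)) (T : Transfer M) :
    X.cc X' h T = ((((X.c₁ T).compContinuousMap (X'.mapIncl M)).cast
        (mapIncl_comp X X' h T) rfl).trans ((X.c₂ T).compContinuousMap (X'.mapIncl M))).trans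
      ((X'.c₁ T).trans (X'.c₂ T)) := by
  have e : ((X.c T).compContinuousMap (X'.mapIncl M)).cast (mapIncl_comp X X' h T) rfl =
      (((X.c₁ T).compContinuousMap (X'.mapIncl M)).cast
        (mapIncl_comp X X' h T) rfl).trans ((X.c₂ T).compContinuousMap (X'.mapIncl M)) := by
    refine ContinuousMap.HomotopyWith.ext fun q => ?_
    refine Eq.trans ?_ (ContinuousMap.HomotopyRel.trans_apply _ _ q).symm
    refine (congrArg (X'.mapIncl M)
      (ContinuousMap.HomotopyRel.trans_apply (X.c₁ T) (X.c₂ T) q)).trans ?_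
    split_ifs <;> rfl
  exact congrArg (fun H => ContinuousMap.HomotopyRel.trans H (X'.c T)) e

theorem c_comp (X : Expansion E₀ E₁ i) (X' : Expansion E₁ E₂ i')
    (h : IsLT E₀ E₂ (i' ∘ i)) (T : Transfer M) :
    PathHomotopic ((X.comp X' h).c T) (X.cc X' h T) := by
  rw [cc_eq_trans]
  -- By definition `c` is `c₁` followed by `c₂`, and `c₁` is `hatPath` at `T(E₀)`; each factor is
  -- split in two.
  refine PathHomotopic.trans ((hatPath_comp X X' h (Z := L.obj P) (T.abs E₀) (T.abs_pt E₀)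
    (X.mapPhi_abs_pt T) (mapIncl_comp X X' h T)).hcomp (c₂_comp X X' h T)) ?_
  -- The middle factors are exchanged by naturality of the hat homotopy of `λ₁₂` along `T(φ₀₁) :
  -- F(φ₀₁) T(E₀) ∼ T(E₁)`.
  have key := (X'.hatPath_natural (Z := L.obj P) (X.mapPhi_abs_pt T) (T.abs_pt E₁) (X.c₂ T)).symm
  refine pathHomotopic_interchange ((X.comp X' h).mapIncl_abs_pt T) _ _ ?_
  rw [homotopyRel_cast_trans_cast]
  exact key

end Expansion
/-! ### Section-preserving expansions of disk bundles -/

namespace Expansion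

variable {P : CGPair} {E₀ E₁ : SmoothBundle P.carrier} {i : E₀.total → E₁.total}
  {M : MultFunctor}

/-- The section-preserving map `φ` as a map of pairs `(E₀, Δ₀) → (E₁, Δ₁)`. -/
def diskHom (X : Expansion E₀ E₁ i) (D₀ : DiskSection E₀) (D₁ : DiskSection E₁)
    (hφ : ∀ b, X.φ (D₀.sec b) = D₁.sec b) : (⟨P, E₀, D₀⟩ : DiskPair) ⟶ ⟨P, E₁, D₁⟩ where
  base := 𝟙 P
  total := X.φ
  diffeo := X.diffeo
  total_sec := hφ

theorem mapPhi_d (X : Expansion E₀ E₁ i) (D₀ : DiskSection E₀) (D₁ : DiskSection E₁)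
    (hφ : ∀ b, X.φ (D₀.sec b) = D₁.sec b) :
    (X.mapPhi M).comp (DiskPair.d M ⟨P, E₀, D₀⟩).toMap = (DiskPair.d M ⟨P, E₁, D₁⟩).toMap := by
  have e : DiskPair.secMap ⟨P, E₀, D₀⟩ ≫ totalMap E₀ E₁ (𝟙 P) X.φ X.diffeo.smooth.continuous
      X.diffeo.smooth.proj_eq = DiskPair.secMap ⟨P, E₁, D₁⟩ :=
    CGPair.Hom.ext (ContinuousMap.ext hφ)
  refine ContinuousMap.ext fun x => ?_
  have h := congrArg (fun k => (PtdTop.Hom.toMap k) ((M.eps.app P).toMap x)) (congrArg M.F.map e)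
  rw [M.F.map_comp] at h
  exact h

/-- The homotopy `F̂(λ)` is constant on `F(Δ₀) ε` if `λ` is constant along the section. -/
theorem hatPath_d (X : Expansion E₀ E₁ i) (D₀ : DiskSection E₀) (D₁ : DiskSection E₁)
    (hi : ∀ b, i (D₀.sec b) = D₁.sec b) (hφ : ∀ b, X.φ (D₀.sec b) = D₁.sec b)
    (hlam : ∀ b t, X.lam (D₀.sec b, t) = D₁.sec b) :
    (X.hatPath (Z := L.obj P) (DiskPair.d M ⟨P, E₀, D₀⟩).toMap
      (DiskPair.d M ⟨P, E₀, D₀⟩).map_pt).cast (X.mapIncl_d D₀ D₁ hi) (X.mapPhi_d D₀ D₁ hφ) =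
    ContinuousMap.HomotopyRel.refl (DiskPair.d M ⟨P, E₁, D₁⟩).toMap {(L.obj P).pt} := by
  refine ContinuousMap.HomotopyWith.ext fun q => ?_
  obtain ⟨t, x⟩ := q
  -- Pulling `F(Δ₀)` through the hat leaves the homotopy `λ_t Δ₀` on the base, which is constant at
  -- `Δ₁`.
  refine (M.hat_map (DiskPair.secMap ⟨P, E₀, D₀⟩) X.lamMap
    (CGPair.prodMap (DiskPair.secMap ⟨P, E₀, D₀⟩) (𝟙 Ipair) ≫ X.lamMap) (fun _ _ => rfl)
    ((M.eps.app P).toMap x) t).trans ?_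
  exact M.hat_const (X := P) (CGPair.prodMap (DiskPair.secMap ⟨P, E₀, D₀⟩) (𝟙 Ipair) ≫ X.lamMap)
    (DiskPair.secMap ⟨P, E₁, D₁⟩) hlam _ t

/-- The value of the simplicial homotopy `d` on `φ : (E₀, Δ₀) → (E₁, Δ₁)`. -/
theorem c₂_homotopic (X : Expansion E₀ E₁ i) (D₀ : DiskSection E₀) (D₁ : DiskSection E₁)
    (hφ : ∀ b, X.φ (D₀.sec b) = D₁.sec b) (T : Transfer M) :
    PathHomotopic (X.c₂ T)
      (((((T.dPath ⟨P, E₀, D₀⟩).symm).compContinuousMap (X.mapPhi M)).cast rfl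
        (X.mapPhi_d D₀ D₁ hφ)).trans (T.dPath ⟨P, E₁, D₁⟩)) := by
  have := contractibleSpace_unitInterval
  have := contractibleSpace_stdSimplex 1
  let u := X.diskHom D₀ D₁ hφ
  let C := ComposableArrows.mk₁ u
  -- The prism `Δ₁ × I` carries `T(φ)` at `0 ∈ I` and the constant path at `F(Δ₁) ε` at `1`. Over
  -- the two vertices of `Δ₁` lie the homotopies of `(E₀, Δ₀)`, composed with `F(φ)`, and of `(E₁,
  -- Δ₁)`.
  let G : C((stdSimplex ℝ (Fin (1 + 1)) × I) × (L.obj P).carrier,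
      (M.F.obj (totalPair P E₁)).carrier) :=
    ⟨fun q => T.d.app C trivial (q.2, q.1.2, q.1.1), (T.d.app C trivial).continuous.comp
      (continuous_snd.prodMk ((continuous_snd.comp continuous_fst).prodMk
        (continuous_fst.comp continuous_fst)))⟩
  have h01 : (0 : Fin 2) ≤ 1 := by decide
  have hedge : ∀ t, edgePath h01 t = stdSimplexHomeomorphUnitInterval.symm t := fun t => by
    rw [Homeomorph.eq_symm_apply]
    have h := simplexToI_edgePath id h01 rfl rfl t
    rwa [simplexToI, ContinuousMap.coe_mk, stdSimplex.map_id_apply] at h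
  have hv₀ : stdSimplex.vertex (S := ℝ) (0 : Fin 2) = stdSimplexHomeomorphUnitInterval.symm 0 :=
    (edgePath h01).source.symm.trans (hedge 0)
  have hv₁ : stdSimplex.vertex (S := ℝ) (1 : Fin 2) = stdSimplexHomeomorphUnitInterval.symm 1 :=
    (edgePath h01).target.symm.trans (hedge 1)
  have h₁ : IsTraced (X := L.obj P) (Y := M.F.obj (totalPair P E₁)) G
      ((edgePath h01).prod (Path.refl (0 : I))) (X.c₂ T) := fun t x => by
    refine Eq.symm ((T.d_zero C x (edgePath h01 t)).trans ?_)
    refine (T.T.app_one_simplex _ (excisiveSimplex_disk C) (excisiveSimplex_absMap X.diffeo)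
      x PUnit.unit _).trans ?_
    rw [hedge]
    rfl
  -- The homotopy `T.d` starts at `T` while `dPath` ends there, so the inverse of `dPath` runs
  -- forward in `I`, and `dPath` itself, in `h₄`, runs backward.
  have h₂ : IsTraced (X := L.obj P) (Y := M.F.obj (totalPair P E₁)) G
      ((Path.refl (stdSimplex.vertex (S := ℝ) (0 : Fin 2))).prod unitPath)
      ((((T.dPath ⟨P, E₀, D₀⟩).symm).compContinuousMap (X.mapPhi M)).cast rfl
        (X.mapPhi_d D₀ D₁ hφ)) := fun t x => by
    refine Eq.trans (congrArg (fun s => X.mapPhi M (T.d.app (ComposableArrows.mk₀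
      (⟨P, E₀, D₀⟩ : DiskPair)) trivial (x, s, default))) (unitInterval.symm_symm t)) ?_
    refine (T.d.app_mk₁_zero u trivial trivial x t).symm.trans ?_
    rw [← hv₀]
    rfl
  have h₃ : IsTraced (X := L.obj P) (Y := M.F.obj (totalPair P E₁)) G
      ((edgePath h01).prod (Path.refl (1 : I)))
      (ContinuousMap.HomotopyRel.refl (DiskPair.d M ⟨P, E₁, D₁⟩).toMap {(L.obj P).pt}) :=
    fun t x => by
      refine Eq.symm ((T.d_one C x (edgePath h01 t)).trans ?_)
      exact congrArg (DiskPair.d M ⟨P, E₁, D₁⟩).toMap (L_map_eq_self (𝟙 P) rfl x)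
  have h₄ : IsTraced (X := L.obj P) (Y := M.F.obj (totalPair P E₁)) G
      ((Path.refl (stdSimplex.vertex (S := ℝ) (1 : Fin 2))).prod unitPath.symm)
      (T.dPath ⟨P, E₁, D₁⟩) := fun t x => by
    refine Eq.trans ?_ ((T.d.app_mk₁_one u trivial trivial x (unitInterval.symm t)).symm.trans ?_)
    · exact congrArg (fun y => T.dPath ⟨P, E₁, D₁⟩ (t, y)) (L_map_eq_self (𝟙 P) rfl x).symm
    · rw [← hv₁]
      rfl
  have hpt : (X.mapPhi M).comp (T.abs E₀) (L.obj P).pt = (M.F.obj (totalPair P E₁)).pt :=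
    X.mapPhi_abs_pt T
  -- One side of the prism is compared with the way round the other three; the constant side is then
  -- dropped.
  refine (h₁.pathHomotopic ((h₂.trans h₃).trans h₄) fun s => ?_).trans
    ((pathHomotopic_trans_refl hpt _).hcomp (.refl _))
  exact T.d.app_pt C trivial s.2 s.1

/-- Once `T(φ)` is replaced by `F(φ) d(E₀, Δ₀)⁻¹` followed by `d(E₁, Δ₁)`, the last factor already
agrees. It remains to compare the hat homotopy followed by `F(φ) d(E₀, Δ₀)⁻¹` with `F(i) d(E₀,
Δ₀)⁻¹`. -/
theorem c_homotopic_dd (X : Expansion E₀ E₁ i) (D₀ : DiskSection E₀) (D₁ : DiskSection E₁)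
    (hi : ∀ b, i (D₀.sec b) = D₁.sec b) (hφ : ∀ b, X.φ (D₀.sec b) = D₁.sec b)
    (hlam : ∀ b t, X.lam (D₀.sec b, t) = D₁.sec b) (T : Transfer M) :
    PathHomotopic (X.c T) (X.dd D₀ D₁ hi T) := by
  have hpt := X.mapIncl_abs_pt T
  -- Naturality along `d(E₀, Δ₀)⁻¹ : T(E₀) ∼ F(Δ₀) ε` moves the hat homotopy to the end, where it
  -- acts on `F(Δ₀) ε`.
  have key := (X.hatPath_natural (Z := L.obj P) (T.abs_pt E₀)
    (DiskPair.d M ⟨P, E₀, D₀⟩).map_pt (T.dPath ⟨P, E₀, D₀⟩).symm).symm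
  refine ((PathHomotopic.refl (X.c₁ T)).hcomp (X.c₂_homotopic D₀ D₁ hφ T)).trans ?_
  refine (pathHomotopic_assoc hpt _ _ _).symm.trans ?_
  refine PathHomotopic.hcomp ?_ (.refl _)
  have e := homotopyRel_cast_trans_cast
    ((T.dPath ⟨P, E₀, D₀⟩).symm.compContinuousMap (X.mapIncl M))
    (X.hatPath (Z := L.obj P) (DiskPair.d M ⟨P, E₀, D₀⟩).toMap (DiskPair.d M ⟨P, E₀, D₀⟩).map_pt)
    rfl (X.mapIncl_d D₀ D₁ hi) (X.mapPhi_d D₀ D₁ hφ)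
  -- After the cast both ends of the hat homotopy are `F(Δ₁) ε`, so it can be identified with the
  -- constant path.
  rw [X.hatPath_d D₀ D₁ hi hφ hlam] at e
  have e' := homotopyRel_cast_trans_cast (X.c₁ T)
    ((T.dPath ⟨P, E₀, D₀⟩).symm.compContinuousMap (X.mapPhi M)) rfl rfl (X.mapPhi_d D₀ D₁ hφ)
  -- The constant path is inserted after `F(i) d(E₀, Δ₀)⁻¹`, which gives the shape of `e`.
  refine PathHomotopic.trans ?_ (pathHomotopic_trans_refl hpt _)
  refine Eq.mpr (congrArg₂ PathHomotopic e' e) ?_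
  exact key

end Expansion

end RefinedTransfer

theorem mainTheorem7 (M : MultFunctor) (T : Transfer M) :
    -- composable expansions
    (∀ (P : CGPair) (E₀ E₁ E₂ : SmoothBundle P.carrier) (i₀₁ : E₀.total → E₁.total)
      (i₁₂ : E₁.total → E₂.total) (X₀₁ : Expansion E₀ E₁ i₀₁) (X₁₂ : Expansion E₁ E₂ i₁₂)
      (h₀₂ : IsLT E₀ E₂ (i₁₂ ∘ i₀₁)),
      PathHomotopic ((X₀₁.comp X₁₂ h₀₂).c T) (X₀₁.cc X₁₂ h₀₂ T)) ∧
    -- section-preserving expansions of disk bundles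
    (∀ (P : CGPair) (E₀ E₁ : SmoothBundle P.carrier) (Δ₀ : DiskSection E₀) (Δ₁ : DiskSection E₁)
      (i₀₁ : E₀.total → E₁.total) (hi : ∀ b, i₀₁ (Δ₀.sec b) = Δ₁.sec b)
      (X : Expansion E₀ E₁ i₀₁) (_ : ∀ b, X.φ (Δ₀.sec b) = Δ₁.sec b)
      (_ : ∀ b t, X.lam (Δ₀.sec b, t) = Δ₁.sec b),
      PathHomotopic (X.c T) (X.dd Δ₀ Δ₁ hi T)) := by
  exact ⟨fun _ _ _ _ _ _ X X' h => X.c_comp X' h T,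
    fun _ _ _ D₀ D₁ _ hi X hφ hlam => X.c_homotopic_dd D₀ D₁ hi hφ hlam T⟩
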